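/- Let $\mathcal X,\mathcal Y,\hat{\mathcal X}$ be finite alphabets, let $P_{XY}$ be a probability mass function on $\mathcal X\times\mathcal Y$, and let $d:\mathcal X\times\hat{\mathcal X}\to[0,\infty)$ be a distortion measure, with per-letter extension $\bar d(x^n,\hat x^n)=\frac1n\sum_{i=1}^n d(x_i,\hat x_i)$. Let $(X^n,Y^n)$ have distribution $P_{X^nY^n}(x^n,y^n)=\prod_{i=1}^n P_{XY}(x_i,y_i)$. For $R\ge 0$, a code of length $n$ and rate $R$ consists of an encoder $f_n:\mathcal Y^n\to\{1,\dots,\lfloor 2^{nR}\rfloor\}$ and a decoder $g_n:\{1,\dots,\lfloor 2^{nR}\rfloor\}\to\hat{\mathcal X}^n$. For a distortion level $\Delta$ put $$p_{\mathrm c}(n,R,\Delta)=\max_{f_n,g_n}\Pr\bigl\{\bar d\bigl(X^n,g_n(f_n(Y^n))\bigr)\le\Delta\bigr\}.$$ Assume $\Delta\ge\Delta_{\min}$, where $\Delta_{\min}=\min_{h:\mathcal Y\to\hat{\mathcal X}}\mathbb E[d(X,h(Y))]$ under $P_{XY}$. Then $p_{\mathrm c}(n,R,\Delta)>0$ for all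 $n$, the limit $$E(R,\Delta)=\lim_{n\to\infty}-\frac1n\log_2 p_{\mathrm c}(n,R,\Delta)$$ exists and is finite, and $$E(R,\Delta)=\min_{Q_{XY}}\bigl\{D(Q_{XY}\|P_{XY})+E(Q_{XY},R,\Delta)\bigr\},$$ where the minimum is over all probability mass functions $Q_{XY}$ on $\mathcal X\times\mathcal Y$ and is attained, and $$E(Q_{XY},R,\Delta)=\min_{Q_{\hat X|XY}:\ \mathbb E_Q[d(X,\hat X)]\le\Delta} I_Q(X;\hat X|Y)+\bigl|I_Q(Y;\hat X)-R\bigr|^+ .$$ Here the joint distribution is $Q_{XY\hat X}=Q_{XY}Q_{\hat X|XY}$, $|a|^+=\max\{0,a\}$, relative entropy and (conditional) mutual information are in bits, $D(Q\|P)=+\infty$ if $Q$ is not absolutely continuous with respect to $P$, and $E(Q_{XY},R,\Delta)=+\infty$ if no $Q_{\hat X|XY}$ satisfies the constraint; if some does, the minimum is attained. -/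

import Mathlib

namespace RemoteLossy

/-! Probability mass functions on a finite alphabet `α` are the elements of `stdSimplex ℝ α`.
All logarithms are to base `2`.  The alphabets are `𝒳` (remote source), `𝒴` (observation) and
`𝒵` (reconstruction, usually written with a hat on `𝒳`). -/

section

variable {𝒳 𝒴 𝒵 : Type*} [Fintype 𝒳] [Fintype 𝒴] [Fintype 𝒵]

/-- Per-letter distortion `(1/n) ∑ i, d (x i) (z i)` of two sequences of length `n`. -/
noncomputable def avgDist (d : 𝒳 → 𝒵 → ℝ) {n : ℕ} (x : Fin n → 𝒳) (z : Fin n → 𝒵) : ℝ :=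
  (1 / (n : ℝ)) * ∑ i, d (x i) (z i)

/-- The number of messages `⌊2 ^ (n R)⌋` at block length `n` and rate `R`. -/
noncomputable def numMessages (n : ℕ) (R : ℝ) : ℕ := ⌊(2 : ℝ) ^ ((n : ℝ) * R)⌋₊

/-- The probability, under the `n`-fold product of `P`, that the code with encoder `f` (which sees
only the observed sequence) and decoder `g` reconstructs the source within distortion `Δ`. -/
noncomputable def successProb (P : 𝒳 × 𝒴 → ℝ) (d : 𝒳 → 𝒵 → ℝ) (Δ : ℝ) {n M : ℕ}
    (f : (Fin n → 𝒴) → Fin M) (g : Fin M → (Fin n → 𝒵)) : ℝ :=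
  ∑ x : Fin n → 𝒳, ∑ y : Fin n → 𝒴,
    if avgDist d x (g (f y)) ≤ Δ then ∏ i, P (x i, y i) else 0

/-- The maximal correct reconstruction probability at block length `n`: the maximum of the success
probability over the (finitely many) codes of rate `R`. -/
noncomputable def maxSuccessProb (P : 𝒳 × 𝒴 → ℝ) (d : 𝒳 → 𝒵 → ℝ) (n : ℕ) (R Δ : ℝ) : ℝ :=
  ⨆ c : ((Fin n → 𝒴) → Fin (numMessages n R)) × (Fin (numMessages n R) → (Fin n → 𝒵)),
    successProb P d Δ c.1 c.2

/-- `Δ_min`: the least expected distortion of a letter-by-letter reconstruction `h` of the source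
from its observation. -/
noncomputable def minDistortion (P : 𝒳 × 𝒴 → ℝ) (d : 𝒳 → 𝒵 → ℝ) : ℝ :=
  ⨅ h : 𝒴 → 𝒵, ∑ x, ∑ y, P (x, y) * d x (h y)

open Classical in
/-- Relative entropy `D(Q ‖ P)` in bits; `⊤` unless `Q` is absolutely continuous with respect to
`P`. -/
noncomputable def relEntropy {α : Type*} [Fintype α] (Q P : α → ℝ) : EReal :=
  if ∀ a, P a = 0 → Q a = 0 then ((∑ a, Q a * Real.logb 2 (Q a / P a) : ℝ) : EReal) else ⊤

/-- Mutual information `I(A; B)` in bits of the two coordinates of a joint pmf `J`. -/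
noncomputable def mutualInfo {α β : Type*} [Fintype α] [Fintype β] (J : α → β → ℝ) : ℝ :=
  ∑ a, ∑ b, J a b * Real.logb 2 (J a b / ((∑ b', J a b') * ∑ a', J a' b))

/-- Conditional mutual information `I(X; Z | Y)` in bits of a joint pmf `T` of `(X, Y, Z)`. -/
noncomputable def condMutualInfo (T : 𝒳 → 𝒴 → 𝒵 → ℝ) : ℝ :=
  ∑ x, ∑ y, ∑ z, T x y z * Real.logb 2
    ((T x y z * ∑ x', ∑ z', T x' y z') / ((∑ z', T x y z') * ∑ x', T x' y z))

/-- The joint pmf `Q(x, y) W(z | x, y)`. -/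
def joint (Q : 𝒳 × 𝒴 → ℝ) (W : 𝒳 × 𝒴 → 𝒵 → ℝ) : 𝒳 → 𝒴 → 𝒵 → ℝ :=
  fun x y z => Q (x, y) * W (x, y) z

/-- The conditional pmfs `W` of the reconstruction given `(X, Y)` for which the expected distortion
under the joint pmf `Q(x, y) W(z | x, y)` is at most `Δ`. -/
def feasible (Q : 𝒳 × 𝒴 → ℝ) (d : 𝒳 → 𝒵 → ℝ) (Δ : ℝ) : Set (𝒳 × 𝒴 → 𝒵 → ℝ) :=
  {W | (∀ p, W p ∈ stdSimplex ℝ 𝒵) ∧ ∑ x, ∑ y, ∑ z, joint Q W x y z * d x z ≤ Δ}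

/-- The objective `I(X; Z | Y) + |I(Y; Z) - R|⁺` under the joint pmf `Q(x, y) W(z | x, y)`. -/
noncomputable def innerObjective (Q : 𝒳 × 𝒴 → ℝ) (R : ℝ) (W : 𝒳 × 𝒴 → 𝒵 → ℝ) : ℝ :=
  condMutualInfo (joint Q W) + max 0 (mutualInfo (fun y z => ∑ x, joint Q W x y z) - R)

/-- `E(Q, R, Δ)`: the infimum of the objective over the feasible conditional pmfs, `⊤` if there are
none. -/
noncomputable def innerExponent (Q : 𝒳 × 𝒴 → ℝ) (d : 𝒳 → 𝒵 → ℝ) (R Δ : ℝ) : EReal :=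
  ⨅ W ∈ feasible Q d Δ, (innerObjective Q R W : EReal)

end

end RemoteLossy

/-! The proof is the method of types. Sort the pairs (x, y) that a code reconstructs by their joint
type with the reconstruction z. All pairs with one joint type `k` are equiprobable, so only their
number matters. It is at most |T_XYZ| · min(|T_Y| / |T_YZ|, M / |T_Z|): each y fixes its z and
leaves at most |T_XYZ| / |T_YZ| choices of x, and each of the M codewords fits at most |T_XYZ| /
|T_Z| pairs (`card_pairsOfType_le`). A random covering of T_Y by codewords from T_Z attains this
bound up to a factor 2 (`exists_covering`, `exists_code`). The number of types is polynomial in n,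
so the best feasible type decides the exponent.

Since |T| is exp(nH) up to a polynomial factor (`abs_log_card_typeClass_sub_le`), a type with
normalized version T has exponent max(H(YZ) - H(Y), H(Z) - R log 2) - H(XYZ) - ∑ T log P, which is
`typeExponent`. For T = Q W this equals log 2 times D(Q‖P) + I(X;Z|Y) + |I(Y;Z) - R|⁺
(`typeExponent_jointTriple`).

The exponent is continuous and the feasible T form a compact set, so a minimizer exists. Normalized
types are themselves feasible points, which gives the converse. For achievability the minimizer is
rounded to types, with the leftover mass placed on a triple of least distortion in the support of P,
so that the constraint survives (`isFeasibleType_roundType`). -/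

namespace RemoteLossy
open Finset
open scoped Nat

set_option linter.unusedSectionVars false

/-! ### Method of types: sizes of type classes and of their fibers. -/

section Types

variable {α β : Type*} [Fintype α] [DecidableEq α] [Fintype β] [DecidableEq β] {n : ℕ}

/-- The number of occurrences of each letter in a sequence (its unnormalized type). -/
def counts (f : Fin n → α) (a : α) : ℕ := #{i | f i = a}

/-- The pushforward of a (signed) mass function. -/
def push {α β M : Type*} [Fintype α] [DecidableEq β] [AddCommMonoid M] (p : α → β) (k : α → M)
    (b : β) : M := ∑ a with p a = b, k a

/-- The sequences of length `n` of type `k`. -/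
def typeClass (n : ℕ) (k : α → ℕ) : Finset (Fin n → α) := {f | counts f = k}


lemma mem_typeClass {k : α → ℕ} {f : Fin n → α} : f ∈ typeClass n k ↔ counts f = k := by
  simp [typeClass]

lemma sum_comp_eq_sum_counts {M : Type*} [AddCommMonoid M] (f : Fin n → α) (u : α → M) :
    ∑ i, u (f i) = ∑ a, counts f a • u a := by
  rw [← Finset.sum_fiberwise univ f]
  refine sum_congr rfl fun a _ => ?_
  rw [sum_congr rfl (g := fun _ => u a) (by simp +contextual), sum_const, counts]

lemma prod_comp_eq_prod_counts {M : Type*} [CommMonoid M] (f : Fin n → α) (u : α → M) :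
    ∏ i, u (f i) = ∏ a, u a ^ counts f a := by
  rw [← Finset.prod_fiberwise univ f]
  refine prod_congr rfl fun a _ => ?_
  rw [prod_congr rfl (g := fun _ => u a) (by simp +contextual), prod_const, counts]

lemma sum_counts (f : Fin n → α) : ∑ a, counts f a = n := by
  simpa [eq_comm] using sum_comp_eq_sum_counts f (fun _ => (1 : ℕ))

lemma counts_comp (p : α → β) (f : Fin n → α) : counts (p ∘ f) = push p (counts f) := by
  ext b
  have := sum_comp_eq_sum_counts f (fun a => if p a = b then 1 else 0)
  simpa [counts, push, sum_filter] using this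

lemma counts_comp_perm (f : Fin n → α) (σ : Equiv.Perm (Fin n)) : counts (f ∘ σ) = counts f := by
  ext a
  exact card_equiv σ (by simp)

lemma exists_perm_of_counts_eq {f g : Fin n → α} (h : counts f = counts g) :
    ∃ σ : Equiv.Perm (Fin n), f ∘ σ = g := by
  have e : ∀ a, {i // g i = a} ≃ {i // f i = a} := fun a =>
    Fintype.equivOfCardEq (by
      have := congrFun h a
      simpa [counts, Fintype.card_subtype] using this.symm)
  refine ⟨(Equiv.sigmaFiberEquiv g).symm.trans
    ((Equiv.sigmaCongrRight e).trans (Equiv.sigmaFiberEquiv f)), ?_⟩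
  ext i
  exact (e (g i) ⟨i, rfl⟩).2

lemma exists_counts_eq {k : α → ℕ} (h : ∑ a, k a = n) : ∃ f : Fin n → α, counts f = k := by
  have e : Fin n ≃ Σ a, Fin (k a) := Fintype.equivOfCardEq (by simp [h])
  refine ⟨fun i => (e i).1, ?_⟩
  ext a
  have h1 : counts (fun i => (e i).1) a = #{s : Σ a, Fin (k a) | s.1 = a} :=
    card_equiv e (by simp)
  rw [h1, card_filter, Fintype.sum_sigma]
  simp [apply_ite card]

/-- Orbit-stabilizer: the permutations of positions act transitively on a type class, and the
stabilizer of a sequence permutes the positions of each letter. -/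
lemma card_typeClass_mul {k : α → ℕ} (h : ∑ a, k a = n) :
    #(typeClass n k) * ∏ a, (k a)! = n ! := by
  obtain ⟨f, rfl⟩ := exists_counts_eq h
  have h1 : n ! = #(univ : Finset (Equiv.Perm (Fin n))) := by
    simp [Fintype.card_perm]
  rw [h1, card_eq_sum_card_fiberwise (f := fun σ : Equiv.Perm (Fin n) => f ∘ σ)
    (t := typeClass n (counts f)) (fun σ _ => by simp [mem_typeClass, counts_comp_perm])]
  rw [sum_congr rfl (g := fun _ => ∏ a, (counts f a)!), sum_const, smul_eq_mul]
  intro g hg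
  obtain ⟨τ, rfl⟩ := exists_perm_of_counts_eq (mem_typeClass.1 hg).symm
  have h2 := DomMulAct.stabilizer_card f
  rw [Fintype.card_subtype] at h2
  simp only [Fintype.card_subtype] at h2
  unfold counts
  rw [← h2]
  -- The permutations carrying `f` to `f ∘ τ` form a coset of the stabilizer of `f`.
  refine card_equiv (Equiv.mulRight τ⁻¹) fun σ => ?_
  simp only [mem_filter, mem_univ, true_and, Equiv.coe_mulRight, Equiv.Perm.coe_mul]
  constructor
  · intro h
    ext i
    simpa using congrFun h (τ⁻¹ i)
  · intro h
    ext i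
    simpa using congrFun h (τ i)

lemma typeClass_card_pos {k : α → ℕ} (h : ∑ a, k a = n) : 0 < #(typeClass n k) := by
  obtain ⟨f, hf⟩ := exists_counts_eq h
  exact card_pos.2 ⟨f, mem_typeClass.2 hf⟩

lemma sum_push {M : Type*} [AddCommMonoid M] (p : α → β) (k : α → M) :
    ∑ b, push p k b = ∑ a, k a := sum_fiberwise univ p k

/-- All sequences of a given type have the same number of preimages of a given type. -/
lemma card_fiber_mul (p : α → β) (k : α → ℕ) {g : Fin n → β}
    (hg : g ∈ typeClass n (push p k)) :
    #{f ∈ typeClass n k | p ∘ f = g} * #(typeClass n (push p k)) = #(typeClass n k) := by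
  rw [card_eq_sum_card_fiberwise (s := typeClass n k) (f := fun f : Fin n → α => p ∘ f)
    (t := typeClass n (push p k)) (fun f hf => by
      have hf' : counts f = k := mem_typeClass.1 hf
      simp [mem_typeClass, counts_comp, hf'])]
  rw [sum_congr rfl (g := fun _ => #{f ∈ typeClass n k | p ∘ f = g}), sum_const, smul_eq_mul,
    mul_comm]
  intro g' hg'
  obtain ⟨σ, rfl⟩ := exists_perm_of_counts_eq
    ((mem_typeClass.1 hg').trans (mem_typeClass.1 hg).symm)
  -- Permuting positions by `σ` preserves the type `k` and carries one fiber bijectively onto the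
  -- other.
  refine card_equiv (Equiv.arrowCongr σ.symm (Equiv.refl α)) fun f => ?_
  simp only [mem_filter, mem_typeClass]
  have e : (Equiv.arrowCongr σ.symm (Equiv.refl α)) f = f ∘ σ := by
    ext i; simp [Equiv.arrowCongr]
  rw [e, counts_comp_perm, ← Function.comp_assoc, σ.surjective.injective_comp_right.eq_iff]

lemma card_fiber_mul_le (p : α → β) (k : α → ℕ) (g : Fin n → β) :
    #{f ∈ typeClass n k | p ∘ f = g} * #(typeClass n (push p k)) ≤ #(typeClass n k) := by
  by_cases hg : g ∈ typeClass n (push p k)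
  · exact (card_fiber_mul p k hg).le
  · rw [filter_false_of_mem, card_empty, zero_mul]
    · exact Nat.zero_le _
    · rintro f hf rfl
      rw [mem_typeClass] at hf
      exact hg (by rw [mem_typeClass, counts_comp, hf])

lemma log_factorial_lower (m : ℕ) : m * Real.log m - m ≤ Real.log (m !) := by
  induction m with
  | zero => simp
  | succ m ih =>
    rcases Nat.eq_zero_or_pos m with rfl | hm
    · simp
    rw [Nat.factorial_succ, Nat.cast_mul, Real.log_mul (by positivity) (by positivity)]
    have hm' : (0 : ℝ) < m := by exact_mod_cast hm
    have := Real.log_le_sub_one_of_pos (x := ((m : ℝ) + 1) / m) (by positivity)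
    rw [Real.log_div (by positivity) (by positivity)] at this
    have h2 : (m : ℝ) * (Real.log (m + 1) - Real.log m) ≤ 1 := by
      calc _ ≤ (m : ℝ) * (((m : ℝ) + 1) / m - 1) := by gcongr
        _ = 1 := by field_simp; ring
    push_cast
    linarith

lemma log_factorial_upper (m : ℕ) :
    Real.log (m !) ≤ m * Real.log m - m + (1 + Real.log (m + 1)) := by
  rcases Nat.eq_zero_or_pos m with rfl | hm
  · simp
  -- With the smaller slack `log m` the induction step is a single use of `log t ≤ t - 1` at t = m /
  -- (m + 1).
  suffices h : Real.log (m !) ≤ m * Real.log m - m + (1 + Real.log m) by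
    have hm' : (0 : ℝ) < m := by exact_mod_cast hm
    have := Real.log_le_log hm' (by linarith : (m : ℝ) ≤ m + 1)
    linarith
  induction m, hm using Nat.le_induction with
  | base => simp
  | succ m hm ih =>
    have hm' : (0 : ℝ) < m := by exact_mod_cast hm
    rw [Nat.factorial_succ, Nat.cast_mul, Real.log_mul (by positivity) (by positivity)]
    have := Real.log_le_sub_one_of_pos (x := (m : ℝ) / (m + 1)) (by positivity)
    rw [Real.log_div (by positivity) (by positivity)] at this
    have h2 : ((m : ℝ) + 1) * (Real.log m - Real.log (m + 1)) ≤ -1 := by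
      calc _ ≤ ((m : ℝ) + 1) * ((m : ℝ) / (m + 1) - 1) := by gcongr
        _ = -1 := by field_simp; ring
    push_cast
    linarith

/-- Shannon entropy in nats. -/
noncomputable def entropy {α : Type*} [Fintype α] (T : α → ℝ) : ℝ := ∑ a, Real.negMulLog (T a)

lemma mul_entropy_div (k : α → ℕ) (h : ∑ a, k a = n) (hn : 0 < n) :
    n * entropy (fun a => (k a : ℝ) / n) = n * Real.log n - ∑ a, k a * Real.log (k a) := by
  have hn' : (n : ℝ) ≠ 0 := by positivity
  have h1 : ∀ a, (n : ℝ) * Real.negMulLog ((k a : ℝ) / n) =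
      k a * Real.log n - k a * Real.log (k a) := by
    intro a
    rcases Nat.eq_zero_or_pos (k a) with h0 | h0
    · simp [h0]
    · rw [Real.negMulLog, Real.log_div (by positivity) hn']
      field_simp
      ring
  rw [entropy, mul_sum, sum_congr rfl fun a _ => h1 a, sum_sub_distrib, ← sum_mul]
  congr 2
  exact_mod_cast h

/-- The size of a type class is exponential with exponent the entropy, up to a polynomial. -/
lemma abs_log_card_typeClass_sub_le (k : α → ℕ) (h : ∑ a, k a = n) (hn : 0 < n) :
    |Real.log #(typeClass n k) - n * entropy (fun a => (k a : ℝ) / n)| ≤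
      Fintype.card α * (1 + Real.log (n + 1)) := by
  have h1 : Real.log #(typeClass n k) + ∑ a, Real.log ((k a)!) = Real.log (n !) := by
    rw [← card_typeClass_mul h, Nat.cast_mul, Nat.cast_prod, Real.log_mul, Real.log_prod]
    · intro a _; positivity
    · have := typeClass_card_pos h; positivity
    · exact prod_ne_zero_iff.2 fun a _ => by positivity
  -- The error of `log (n !)` is a single term `1 + log (n + 1)`; it fits in the bound because the
  -- alphabet has at least one letter.
  have hne : Nonempty α := by
    by_contra hα
    rw [not_nonempty_iff] at hα
    simp at h
    omega
  have hL : 0 ≤ 1 + Real.log ((n : ℝ) + 1) := by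
    have := Real.log_nonneg (x := (n : ℝ) + 1) (by linarith [(Nat.cast_nonneg n : (0 : ℝ) ≤ n)])
    linarith
  have hc : (1 : ℝ) ≤ Fintype.card α := by exact_mod_cast Fintype.card_pos
  have hsum : ∑ a, (k a : ℝ) = n := by exact_mod_cast h
  have hlow : ∑ a, (k a : ℝ) * Real.log (k a) - n ≤ ∑ a, Real.log ((k a)!) := by
    rw [← hsum, ← sum_sub_distrib]
    exact sum_le_sum fun a _ => log_factorial_lower (k a)
  have hup : ∑ a, Real.log ((k a)!) ≤ ∑ a, (k a : ℝ) * Real.log (k a) - n +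
      Fintype.card α * (1 + Real.log (n + 1)) := by
    rw [← hsum, ← sum_sub_distrib, hsum]
    have : (Fintype.card α : ℝ) * (1 + Real.log (n + 1)) = ∑ _a : α, (1 + Real.log (n + 1)) := by
      rw [sum_const, nsmul_eq_mul, card_univ]
    rw [this, ← sum_add_distrib]
    refine sum_le_sum fun a _ => (log_factorial_upper (k a)).trans ?_
    have : (k a : ℝ) ≤ n := by
      rw [← hsum]; exact single_le_sum (f := fun a => (k a : ℝ)) (by simp) (mem_univ a)
    gcongr
  have h3 := log_factorial_lower n
  have h4 := log_factorial_upper n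
  have h5 := mul_entropy_div k h hn
  have h6 := mul_le_mul_of_nonneg_right hc hL
  rw [abs_le]
  constructor <;> linarith

end Types

/-! ### Random covering by codewords. -/

section Covering

/-- The chain is (1 - q)^M ≤ exp(-t) ≤ 1 / (1 + t) with t = M q; for t ≥ 1 the last term is at most
1/2, and for t ≤ 1 at most 1 - t/2. -/
lemma one_sub_pow_le {q : ℝ} (h0 : 0 ≤ q) (h1 : q ≤ 1) (M : ℕ) :
    (1 - q) ^ M ≤ 1 - min 1 (M * q) / 2 := by
  have ht : 0 ≤ (M : ℝ) * q := by positivity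
  have h2 : (1 - q) ^ M ≤ Real.exp (-(M * q)) := by
    calc (1 - q) ^ M ≤ Real.exp (-q) ^ M :=
          pow_le_pow_left₀ (by linarith) (Real.one_sub_le_exp_neg q) M
      _ = Real.exp (-(M * q)) := by rw [← Real.exp_nat_mul]; congr 1; ring
  have h3 : Real.exp (-(M * q)) ≤ 1 / (1 + M * q) := by
    rw [Real.exp_neg, ← one_div]
    exact one_div_le_one_div_of_le (by linarith) (by linarith [Real.add_one_le_exp (M * q)])
  refine h2.trans (h3.trans ?_)
  rw [div_le_iff₀ (by linarith)]
  rcases le_total 1 ((M : ℝ) * q) with h | h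
  · rw [min_eq_left h]; linarith
  · rw [min_eq_right h]; nlinarith

/-- Random covering: if every `y ∈ S` is related to at least `K` elements of `U`, then some `M`
elements of `U` cover a fraction `min 1 (M K / #U) / 2` of `S`. -/
lemma exists_covering {σ τ : Type*} [DecidableEq τ] (S : Finset σ) (U : Finset τ)
    (hU : U.Nonempty) (r : σ → τ → Prop) [∀ y z, Decidable (r y z)] (K : ℝ) (hK : 0 ≤ K)
    (h : ∀ y ∈ S, K ≤ #{z ∈ U | r y z}) (M : ℕ) :
    ∃ c : Fin M → τ, min 1 (M * (K / #U)) / 2 * #S ≤ #{y ∈ S | ∃ m, r y (c m)} := by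
  set C := Fintype.piFinset (fun _ : Fin M => U) with hC
  have hCne : C.Nonempty := Fintype.piFinset_nonempty.2 fun _ => hU
  have hUpos : (0 : ℝ) < #U := by exact_mod_cast hU.card_pos
  have hcardC : (#C : ℝ) = (#U : ℝ) ^ M := by simp [hC, Fintype.card_piFinset]
  have key : ∀ y ∈ S, (#C : ℝ) * (min 1 (M * (K / #U)) / 2) ≤ #{c ∈ C | ∃ m, r y (c m)} := by
    intro y hy
    have hKU : K ≤ #U := (h y hy).trans (by exact_mod_cast card_filter_le _ _)
    have e1 : #{c ∈ C | ∃ m, r y (c m)} + #{c ∈ C | ¬ ∃ m, r y (c m)} = #C :=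
      card_filter_add_card_filter_not _
    -- The codebooks missing `y` form a product set, as for independent uniform codewords, so their
    -- proportion is at most (1 - K / #U)^M.
    have e2 : {c ∈ C | ¬ ∃ m, r y (c m)} = Fintype.piFinset (fun _ : Fin M => {z ∈ U | ¬ r y z}) := by
      ext c
      simp [hC, Fintype.mem_piFinset, forall_and]
    have e3 : #{z ∈ U | r y z} + #{z ∈ U | ¬ r y z} = #U := card_filter_add_card_filter_not _
    have e4 : (#{z ∈ U | ¬ r y z} : ℝ) ≤ #U * (1 - K / #U) := by
      have : (#{z ∈ U | r y z} : ℝ) + #{z ∈ U | ¬ r y z} = #U := by exact_mod_cast e3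
      have h' := h y hy
      have : (#U : ℝ) * (1 - K / #U) = #U - K := by field_simp
      linarith
    have e5 : (#{c ∈ C | ¬ ∃ m, r y (c m)} : ℝ) ≤ #C * (1 - min 1 (M * (K / #U)) / 2) := by
      rw [e2, Fintype.card_piFinset, prod_const, card_univ, Fintype.card_fin, hcardC, Nat.cast_pow]
      calc _ ≤ ((#U : ℝ) * (1 - K / #U)) ^ M := pow_le_pow_left₀ (by positivity) e4 M
        _ = (#U : ℝ) ^ M * (1 - K / #U) ^ M := mul_pow _ _ _
        _ ≤ _ := by
          gcongr
          exact one_sub_pow_le (by positivity) ((div_le_one hUpos).2 hKU) M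
    have e6 : (#{c ∈ C | ∃ m, r y (c m)} : ℝ) + #{c ∈ C | ¬ ∃ m, r y (c m)} = #C := by
      exact_mod_cast e1
    linarith
  -- Double counting: averaged over all codebooks, the covered part of `S` is already large enough.
  have hsum : ∑ _c ∈ C, min 1 (M * (K / #U)) / 2 * (#S : ℝ) ≤
      ∑ c ∈ C, (#{y ∈ S | ∃ m, r y (c m)} : ℝ) := by
    have swap : ∑ c ∈ C, (#{y ∈ S | ∃ m, r y (c m)} : ℝ) =
        ∑ y ∈ S, (#{c ∈ C | ∃ m, r y (c m)} : ℝ) := by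
      simp only [card_filter, Nat.cast_sum]
      exact sum_comm
    rw [swap, sum_const, nsmul_eq_mul]
    calc _ = ∑ _y ∈ S, (#C : ℝ) * (min 1 (M * (K / #U)) / 2) := by
          rw [sum_const, nsmul_eq_mul]; ring
      _ ≤ _ := sum_le_sum key
  obtain ⟨c, -, hc⟩ := exists_le_of_sum_le hCne hsum
  exact ⟨c, hc⟩

end Covering

/-! ### Converse and achievability at a fixed block length. -/

section Codes

variable {𝒳 𝒴 𝒵 : Type*} [Fintype 𝒳] [Fintype 𝒴] [Fintype 𝒵]
  [DecidableEq 𝒳] [DecidableEq 𝒴] [DecidableEq 𝒵] {n M : ℕ}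

/-- Three sequences as a sequence of triples. -/
def zip3 (x : Fin n → 𝒳) (y : Fin n → 𝒴) (z : Fin n → 𝒵) : Fin n → 𝒳 × 𝒴 × 𝒵 :=
  fun i => (x i, y i, z i)

/-- The joint types of length `n` whose expected distortion is at most `Δ`. -/
def IsFeasibleType (d : 𝒳 → 𝒵 → ℝ) (Δ : ℝ) (n : ℕ) (k : 𝒳 × 𝒴 × 𝒵 → ℕ) : Prop :=
  ∑ a, k a = n ∧ (1 / (n : ℝ)) * ∑ a, k a * d a.1 a.2.2 ≤ Δ

/-- The `n`-fold product probability of a pair of sequences whose joint type with a third one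
is `k`. -/
def typeWeight (P : 𝒳 × 𝒴 → ℝ) (k : 𝒳 × 𝒴 × 𝒵 → ℕ) : ℝ := ∏ a, P (a.1, a.2.1) ^ k a

/-- The contribution of the joint type `k` to the success probability of the best code with `M`
messages, up to a constant factor. -/
noncomputable def typeBound (P : 𝒳 × 𝒴 → ℝ) (n M : ℕ) (k : 𝒳 × 𝒴 × 𝒵 → ℕ) : ℝ :=
  min ((#(typeClass n (push (fun a => a.2.1) k)) : ℝ) / #(typeClass n (push Prod.snd k)))
    (M / #(typeClass n (push (fun a => a.2.2) k))) * #(typeClass n k) * typeWeight P k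

lemma avgDist_eq_counts (d : 𝒳 → 𝒵 → ℝ) (x : Fin n → 𝒳) (y : Fin n → 𝒴) (z : Fin n → 𝒵) :
    avgDist d x z = (1 / (n : ℝ)) * ∑ a, counts (zip3 x y z) a * d a.1 a.2.2 := by
  rw [avgDist]
  congr 1
  simpa [zip3] using sum_comp_eq_sum_counts (zip3 x y z) (fun a => d a.1 a.2.2)

lemma prod_eq_typeWeight (P : 𝒳 × 𝒴 → ℝ) (x : Fin n → 𝒳) (y : Fin n → 𝒴) (z : Fin n → 𝒵) :
    ∏ i, P (x i, y i) = typeWeight P (counts (zip3 x y z)) := by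
  simpa [zip3, typeWeight] using prod_comp_eq_prod_counts (zip3 x y z) (fun a => P (a.1, a.2.1))

lemma isFeasibleType_counts {d : 𝒳 → 𝒵 → ℝ} {Δ : ℝ} {x : Fin n → 𝒳} {y : Fin n → 𝒴}
    {z : Fin n → 𝒵} : IsFeasibleType d Δ n (counts (zip3 x y z)) ↔ avgDist d x z ≤ Δ := by
  rw [IsFeasibleType, ← avgDist_eq_counts]
  simp [sum_counts]

/-- The pairs of sequences whose joint type with the reconstruction is `k`. -/
def pairsOfType (f : (Fin n → 𝒴) → Fin M) (g : Fin M → (Fin n → 𝒵)) (k : 𝒳 × 𝒴 × 𝒵 → ℕ) :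
    Finset ((Fin n → 𝒳) × (Fin n → 𝒴)) :=
  {q | counts (zip3 q.1 q.2 (g (f q.2))) = k}

lemma typeWeight_nonneg {P : 𝒳 × 𝒴 → ℝ} (hP : ∀ q, 0 ≤ P q) (k : 𝒳 × 𝒴 × 𝒵 → ℕ) :
    0 ≤ typeWeight P k := prod_nonneg fun _ _ => pow_nonneg (hP _) _

lemma zip3_injOn {s : Set ((Fin n → 𝒳) × (Fin n → 𝒴))} (z : (Fin n → 𝒴) → Fin n → 𝒵) :
    Set.InjOn (fun q : (Fin n → 𝒳) × (Fin n → 𝒴) => zip3 q.1 q.2 (z q.2)) s := by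
  rintro ⟨x, y⟩ - ⟨x', y'⟩ - h
  simp only [zip3, funext_iff, Prod.mk.injEq] at h
  ext i
  · exact (h i).1
  · exact (h i).2.1

lemma card_typeClass_push_pos {α β : Type*} [Fintype α] [DecidableEq α] [Fintype β]
    [DecidableEq β] {k : α → ℕ} (hk : ∑ a, k a = n) (p : α → β) :
    0 < #(typeClass n (push p k)) := typeClass_card_pos (by rw [sum_push, hk])

lemma card_fiber_le_div {α β : Type*} [Fintype α] [DecidableEq α] [Fintype β]
    [DecidableEq β] {k : α → ℕ} (hk : ∑ a, k a = n) (p : α → β) (g : Fin n → β) :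
    (#{t ∈ typeClass n k | p ∘ t = g} : ℝ) ≤ #(typeClass n k) / #(typeClass n (push p k)) := by
  rw [le_div_iff₀ (by exact_mod_cast card_typeClass_push_pos hk p)]
  exact_mod_cast card_fiber_mul_le p k g

lemma push_push {α β γ N : Type*} [Fintype α] [Fintype β] [DecidableEq β] [DecidableEq γ]
    [AddCommMonoid N] (p : α → β) (q : β → γ) (k : α → N) :
    push q (push p k) = push (q ∘ p) k := by
  ext c
  simp only [push, Function.comp]
  rw [← sum_fiberwise_of_maps_to (s := {a | q (p a) = c}) (t := {b | q b = c}) (g := p)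
    (by simp)]
  refine sum_congr rfl fun b hb => sum_congr ?_ fun _ _ => rfl
  ext a
  simp only [mem_filter, mem_univ, true_and] at hb ⊢
  constructor
  · rintro rfl; exact ⟨hb, rfl⟩
  · exact fun h => h.2

/-- Two counts of the same set. Grouping by `y` fixes the pair (y, z) and uses fibers over (Y, Z);
grouping by the message fixes only z and uses fibers over Z. -/
lemma card_pairsOfType_le (f : (Fin n → 𝒴) → Fin M) (g : Fin M → (Fin n → 𝒵))
    {k : 𝒳 × 𝒴 × 𝒵 → ℕ} (hk : ∑ a, k a = n) :
    (#(pairsOfType f g k) : ℝ) ≤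
      min ((#(typeClass n (push (fun a => a.2.1) k)) : ℝ) / #(typeClass n (push Prod.snd k)))
        (M / #(typeClass n (push (fun a => a.2.2) k))) * #(typeClass n k) := by
  rw [min_mul_of_nonneg _ _ (by positivity), le_min_iff]
  constructor
  · have h1 : #(pairsOfType f g k) ≤ ∑ y ∈ typeClass n (push (fun a => a.2.1) k),
        #{t ∈ typeClass n k | Prod.snd ∘ t = fun i => (y i, g (f y) i)} := by
      refine le_trans ?_ card_biUnion_le
      refine card_le_card_of_injOn _ ?_ (zip3_injOn fun y => g (f y))
      rintro ⟨x, y⟩ h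
      simp only [pairsOfType, coe_filter, mem_univ, true_and, Set.mem_ofPred_eq] at h
      simp only [coe_biUnion, Set.mem_iUnion, mem_coe, mem_filter]
      refine ⟨y, ?_, mem_typeClass.2 h, rfl⟩
      rw [mem_typeClass, ← h, ← counts_comp]
      rfl
    calc (#(pairsOfType f g k) : ℝ) ≤ ∑ y ∈ typeClass n (push (fun a => a.2.1) k),
          (#{t ∈ typeClass n k | Prod.snd ∘ t = fun i => (y i, g (f y) i)} : ℝ) := by
          exact_mod_cast h1
      _ ≤ ∑ y ∈ typeClass n (push (fun a => a.2.1) k),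
          (#(typeClass n k) : ℝ) / #(typeClass n (push Prod.snd k)) :=
          sum_le_sum fun y _ => card_fiber_le_div hk _ _
      _ = _ := by rw [sum_const, nsmul_eq_mul]; ring
  · have h1 : #(pairsOfType f g k) ≤ ∑ m : Fin M,
        #{t ∈ typeClass n k | (fun a => a.2.2) ∘ t = g m} := by
      refine le_trans ?_ card_biUnion_le
      refine card_le_card_of_injOn _ ?_ (zip3_injOn fun y => g (f y))
      rintro ⟨x, y⟩ h
      simp only [pairsOfType, coe_filter, mem_univ, true_and, Set.mem_ofPred_eq] at h
      simp only [coe_biUnion, Set.mem_iUnion, mem_coe, mem_filter]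
      exact ⟨f y, mem_univ _, mem_typeClass.2 h, rfl⟩
    calc (#(pairsOfType f g k) : ℝ) ≤ ∑ m : Fin M,
          (#{t ∈ typeClass n k | (fun a => a.2.2) ∘ t = g m} : ℝ) := by
          exact_mod_cast h1
      _ ≤ ∑ m : Fin M,
          (#(typeClass n k) : ℝ) / #(typeClass n (push (fun a => a.2.2) k)) :=
          sum_le_sum fun y _ => card_fiber_le_div hk _ _
      _ = _ := by rw [sum_const, nsmul_eq_mul, card_univ, Fintype.card_fin]; ring

/-- Converse: no code does better than the best joint type, up to the number of types. -/
lemma successProb_le {P : 𝒳 × 𝒴 → ℝ} (hP : ∀ q, 0 ≤ P q) (d : 𝒳 → 𝒵 → ℝ) (Δ : ℝ)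
    (f : (Fin n → 𝒴) → Fin M) (g : Fin M → (Fin n → 𝒵)) {B : ℝ} (hB : 0 ≤ B)
    (h : ∀ k : 𝒳 × 𝒴 × 𝒵 → ℕ, IsFeasibleType d Δ n k → typeBound P n M k ≤ B) :
    successProb P d Δ f g ≤ ((n : ℝ) + 1) ^ Fintype.card (𝒳 × 𝒴 × 𝒵) * B := by
  classical
  have e : successProb P d Δ f g = ∑ q : (Fin n → 𝒳) × (Fin n → 𝒴),
      if IsFeasibleType d Δ n (counts (zip3 q.1 q.2 (g (f q.2)))) then
        typeWeight P (counts (zip3 q.1 q.2 (g (f q.2)))) else 0 := by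
    rw [successProb, Fintype.sum_prod_type]
    refine sum_congr rfl fun x _ => sum_congr rfl fun y _ => ?_
    simp only [isFeasibleType_counts, ← prod_eq_typeWeight]
  -- Every letter count is at most `n`, so the joint types lie in a box of (n + 1)^|𝒳 × 𝒴 × 𝒵|
  -- points.
  rw [e, ← sum_fiberwise_of_maps_to
    (t := Fintype.piFinset fun _ : 𝒳 × 𝒴 × 𝒵 => range (n + 1))
    (g := fun q => counts (zip3 q.1 q.2 (g (f q.2))))
    (fun q _ => by
      rw [Fintype.mem_piFinset]
      intro a
      rw [mem_range, Nat.lt_succ_iff, counts]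
      simpa using card_filter_le (univ : Finset (Fin n)) _)]
  have hcard : ((n : ℝ) + 1) ^ Fintype.card (𝒳 × 𝒴 × 𝒵) * B =
      ∑ _k ∈ Fintype.piFinset fun _ : 𝒳 × 𝒴 × 𝒵 => range (n + 1), B := by
    rw [sum_const, nsmul_eq_mul, Fintype.card_piFinset, prod_const, card_range, card_univ]
    push_cast
    rfl
  rw [hcard]
  refine sum_le_sum fun k _ => ?_
  rw [sum_congr rfl (g := fun _ => if IsFeasibleType d Δ n k then typeWeight P k else 0)
    (by
      intro q hq
      rw [(mem_filter.1 hq).2]), sum_const, nsmul_eq_mul]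
  split_ifs with hk
  · refine le_trans ?_ (h k hk)
    exact mul_le_mul_of_nonneg_right (card_pairsOfType_le f g hk.1) (typeWeight_nonneg hP k)
  · simpa using hB

/-- Achievability: some code does as well as any joint type, up to a constant factor. -/
lemma exists_code {P : 𝒳 × 𝒴 → ℝ} (hP : ∀ q, 0 ≤ P q) (d : 𝒳 → 𝒵 → ℝ) (Δ : ℝ) (hM : 0 < M)
    {k : 𝒳 × 𝒴 × 𝒵 → ℕ} (hk : IsFeasibleType d Δ n k) :
    ∃ (f : (Fin n → 𝒴) → Fin M) (g : Fin M → (Fin n → 𝒵)),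
      typeBound P n M k / 2 ≤ successProb P d Δ f g := by
  classical
  set NX := typeClass n k with hNX
  set TYZ := typeClass n (push Prod.snd k) with hTYZ
  set TY := typeClass n (push (fun a => a.2.1) k) with hTY
  set TZ := typeClass n (push (fun a => a.2.2) k) with hTZ
  have pYZ : (0 : ℝ) < #TYZ := Nat.cast_pos.2 (card_typeClass_push_pos hk.1 _)
  have pY : (0 : ℝ) < #TY := Nat.cast_pos.2 (card_typeClass_push_pos hk.1 _)
  have pZ : (0 : ℝ) < #TZ := Nat.cast_pos.2 (card_typeClass_push_pos hk.1 _)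
  -- A codeword covers `y` when their joint type is the (Y, Z) marginal of `k`.
  let r : (Fin n → 𝒴) → (Fin n → 𝒵) → Prop := fun y z => (fun i => (y i, z i)) ∈ TYZ
  have hr : ∀ y ∈ TY, (#TYZ : ℝ) / #TY ≤ #{z ∈ TZ | r y z} := by
    intro y hy
    have e : push Prod.fst (push Prod.snd k) = push (fun a : 𝒳 × 𝒴 × 𝒵 => a.2.1) k :=
      push_push _ _ _
    have h1 := card_fiber_mul (n := n) Prod.fst (push Prod.snd k) (g := y) (by rw [e]; exact hy)
    rw [e] at h1
    rw [div_le_iff₀ pY]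
    have h2 : #{t ∈ TYZ | Prod.fst ∘ t = y} ≤ #{z ∈ TZ | r y z} := by
      refine card_le_card_of_injOn (fun t => Prod.snd ∘ t) ?_ ?_
      · intro t ht
        simp only [coe_filter, Set.mem_ofPred_eq] at ht ⊢
        have e2 : (fun i => (y i, (Prod.snd ∘ t) i)) = t := by
          ext i
          · exact (congrFun ht.2 i).symm
          · rfl
        refine ⟨?_, ?_⟩
        · rw [hTZ, mem_typeClass, counts_comp, mem_typeClass.1 ht.1, push_push]
          rfl
        · show (fun i => (y i, (Prod.snd ∘ t) i)) ∈ TYZ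
          rw [e2]; exact ht.1
      · intro t ht t' ht' htt
        simp only [coe_filter, Set.mem_ofPred_eq] at ht ht'
        ext i
        · exact (congrFun ht.2 i).trans (congrFun ht'.2 i).symm
        · exact congrFun htt i
    calc (#TYZ : ℝ) = #{t ∈ TYZ | Prod.fst ∘ t = y} * #TY := by exact_mod_cast h1.symm
      _ ≤ _ := by gcongr
  obtain ⟨c, hc⟩ := exists_covering TY TZ (card_pos.1 (card_typeClass_push_pos hk.1 _)) r _ (by positivity) hr M
  -- The encoder names a codeword covering `y`; an uncovered `y` gets the arbitrary message 0 and is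
  -- not counted.
  refine ⟨fun y => if h : ∃ m, r y (c m) then h.choose else ⟨0, hM⟩, c, ?_⟩
  set f : (Fin n → 𝒴) → Fin M := fun y => if h : ∃ m, r y (c m) then h.choose else ⟨0, hM⟩
    with hf
  have hcov : ∀ y, (∃ m, r y (c m)) → r y (c (f y)) := by
    intro y h
    simp only [hf, dif_pos h]
    exact h.choose_spec
  have e : successProb P d Δ f c = ∑ y, ∑ x,
      if avgDist d x (c (f y)) ≤ Δ then ∏ i, P (x i, y i) else 0 := sum_comm
  -- Once y and its codeword have the right joint type, the fiber count supplies |T_XYZ| / |T_YZ|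
  -- sources x completing it to `k`, and each meets the distortion constraint.
  have hinner : ∀ y, (∃ m, r y (c m)) → (#NX : ℝ) / #TYZ * typeWeight P k ≤
      ∑ x, if avgDist d x (c (f y)) ≤ Δ then ∏ i, P (x i, y i) else 0 := by
    intro y hy
    have h1 := card_fiber_mul (n := n) Prod.snd k (hcov y hy)
    have h2 : #{t ∈ NX | Prod.snd ∘ t = fun i => (y i, c (f y) i)} ≤
        #{x | counts (zip3 x y (c (f y))) = k} := by
      refine card_le_card_of_injOn (fun t => Prod.fst ∘ t) ?_ ?_
      · intro t ht
        simp only [coe_filter, Set.mem_ofPred_eq, mem_univ, true_and] at ht ⊢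
        have e2 : zip3 (Prod.fst ∘ t) y (c (f y)) = t := by
          ext i : 1
          exact Prod.ext rfl (congrFun ht.2 i).symm
        rw [e2]
        exact mem_typeClass.1 ht.1
      · intro t ht t' ht' htt
        simp only [coe_filter, Set.mem_ofPred_eq] at ht ht'
        ext i : 1
        exact Prod.ext (congrFun htt i) ((congrFun ht.2 i).trans (congrFun ht'.2 i).symm)
    have h3 : (#NX : ℝ) / #TYZ ≤ #{x | counts (zip3 x y (c (f y))) = k} := by
      rw [div_le_iff₀ pYZ]
      calc (#NX : ℝ) = #{t ∈ NX | Prod.snd ∘ t = fun i => (y i, c (f y) i)} * #TYZ := by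
            exact_mod_cast h1.symm
        _ ≤ _ := by gcongr
    calc (#NX : ℝ) / #TYZ * typeWeight P k
        ≤ #{x | counts (zip3 x y (c (f y))) = k} * typeWeight P k :=
          mul_le_mul_of_nonneg_right h3 (typeWeight_nonneg hP k)
      _ = ∑ x with counts (zip3 x y (c (f y))) = k, typeWeight P k := by
          rw [sum_const, nsmul_eq_mul]
      _ = ∑ x with counts (zip3 x y (c (f y))) = k,
          if avgDist d x (c (f y)) ≤ Δ then ∏ i, P (x i, y i) else 0 := by
          refine sum_congr rfl fun x hx => ?_
          have hx' := (mem_filter.1 hx).2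
          rw [if_pos, prod_eq_typeWeight P x y (c (f y)), hx']
          rw [← isFeasibleType_counts (y := y), hx']
          exact hk
      _ ≤ _ := by
          refine sum_le_sum_of_subset_of_nonneg (filter_subset _ _) fun x _ _ => ?_
          split_ifs
          · exact prod_nonneg fun _ _ => hP _
          · exact le_rfl
  have hw := typeWeight_nonneg hP k
  calc typeBound P n M k / 2
      = min 1 (M * ((#TYZ : ℝ) / #TY / #TZ)) / 2 * #TY * (#NX / #TYZ * typeWeight P k) := by
        have : min ((#TY : ℝ) / #TYZ) (M / #TZ) =
            min 1 (M * ((#TYZ : ℝ) / #TY / #TZ)) * (#TY / #TYZ) := by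
          rw [min_mul_of_nonneg _ _ (by positivity)]
          congr 1
          · rw [one_mul]
          · field_simp
        rw [typeBound, this]
        ring
    _ ≤ #{y ∈ TY | ∃ m, r y (c m)} * (#NX / #TYZ * typeWeight P k) := by gcongr
    _ = ∑ y ∈ TY with ∃ m, r y (c m), (#NX / #TYZ * typeWeight P k) := by
        rw [sum_const, nsmul_eq_mul]
    _ ≤ ∑ y ∈ TY with ∃ m, r y (c m),
        ∑ x, if avgDist d x (c (f y)) ≤ Δ then ∏ i, P (x i, y i) else 0 :=
        sum_le_sum fun y hy => hinner y (mem_filter.1 hy).2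
    _ ≤ successProb P d Δ f c := by
        rw [e]
        refine sum_le_sum_of_subset_of_nonneg (subset_univ _) fun y _ _ => sum_nonneg fun x _ => ?_
        split_ifs
        · exact prod_nonneg fun _ _ => hP _
        · exact le_rfl

end Codes

/-! ### Information quantities as combinations of entropies of marginals. -/

section Entropy

variable {α β γ : Type*} [Fintype α] [Fintype β] [DecidableEq β] [Fintype γ] [DecidableEq γ]

/-- The decidability instance may vary with `a`: a condition on tuples can simplify to one free of
the summation variable while its instance still mentions it. -/
lemma sum_ite_zero_right (q : Prop) [Decidable q] (inst : α → Decidable q) (u : α → ℝ) :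
    (∑ a, @ite _ q (inst a) (u a) 0) = if q then ∑ a, u a else 0 := by
  split_ifs <;> simp

lemma push_nonneg (p : α → β) {T : α → ℝ} (hT : ∀ a, 0 ≤ T a) (b : β) : 0 ≤ push p T b :=
  sum_nonneg fun a _ => hT a

/-- A positive mass forces positive marginals, which lets the logarithms of quotients below be
split; terms of zero mass vanish anyway. -/
lemma le_push (p : α → β) {T : α → ℝ} (hT : ∀ a, 0 ≤ T a) (a : α) : T a ≤ push p T (p a) :=
  single_le_sum (f := T) (fun a _ => hT a) (by simp)

lemma sum_mul_comp (p : α → β) (T : α → ℝ) (u : β → ℝ) :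
    ∑ a, T a * u (p a) = ∑ b, push p T b * u b := by
  rw [← sum_fiberwise univ p]
  refine sum_congr rfl fun b _ => ?_
  rw [push, sum_mul]
  exact sum_congr rfl fun a ha => by rw [(mem_filter.1 ha).2]

lemma entropy_eq_neg_sum (T : α → ℝ) : entropy T = -∑ a, T a * Real.log (T a) := by
  simp [entropy, Real.negMulLog]

lemma sum_mul_log_push (p : α → β) (T : α → ℝ) :
    ∑ a, T a * Real.log (push p T (p a)) = -entropy (push p T) := by
  rw [sum_mul_comp p T (fun b => Real.log (push p T b)), entropy_eq_neg_sum, neg_neg]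

lemma continuous_entropy : Continuous (entropy : (α → ℝ) → ℝ) :=
  continuous_finsetSum _ fun a _ => Real.continuous_negMulLog.comp (continuous_apply a)

lemma continuous_push (p : α → β) : Continuous (push p : (α → ℝ) → β → ℝ) :=
  continuous_pi fun _ => continuous_finsetSum _ fun a _ => continuous_apply a

lemma push_div (p : α → β) (k : α → ℕ) (n : ℕ) :
    push p (fun a => (k a : ℝ) / n) = fun b => ((push p k b : ℕ) : ℝ) / n := by
  ext b
  simp [push, sum_div]

lemma mutualInfo_eq (J : β × γ → ℝ) (hJ : ∀ a, 0 ≤ J a) :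
    Real.log 2 * mutualInfo (fun y z => J (y, z)) =
      entropy (push Prod.fst J) + entropy (push Prod.snd J) - entropy J := by
  have h1 : ∀ y, ∑ z, J (y, z) = push Prod.fst J y := fun y => by
    simp [push, sum_filter, Fintype.sum_prod_type, sum_ite_zero_right]
  have h2 : ∀ z, ∑ y, J (y, z) = push Prod.snd J z := fun z => by
    simp [push, sum_filter, Fintype.sum_prod_type]
  have hl : Real.log 2 ≠ 0 := by positivity
  rw [mutualInfo, ← Fintype.sum_prod_type'
    (f := fun y z => J (y, z) * Real.logb 2 (J (y, z) / ((∑ b', J (y, b')) * ∑ a', J (a', z)))),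
    mul_sum]
  have h3 : ∀ a : β × γ, Real.log 2 * (J (a.1, a.2) * Real.logb 2 (J (a.1, a.2) /
      ((∑ b', J (a.1, b')) * ∑ a', J (a', a.2)))) =
      J a * Real.log (J a) - J a * Real.log (push Prod.fst J (Prod.fst a)) -
        J a * Real.log (push Prod.snd J (Prod.snd a)) := by
    intro a
    rw [h1, h2, Prod.mk.eta]
    rcases (hJ a).eq_or_lt with h0 | h0
    · simp [← h0]
    · have p1 := h0.trans_le (le_push Prod.fst hJ a)
      have p2 := h0.trans_le (le_push Prod.snd hJ a)
      rw [Real.logb, Real.log_div h0.ne' (mul_pos p1 p2).ne', Real.log_mul p1.ne' p2.ne']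
      field_simp
      ring
  rw [sum_congr rfl fun a _ => h3 a, sum_sub_distrib, sum_sub_distrib, sum_mul_log_push,
    sum_mul_log_push, entropy_eq_neg_sum J]
  ring

lemma relEntropy_eq {P Q : α → ℝ} (h : ∀ a, P a = 0 → Q a = 0) :
    ∃ D : ℝ, relEntropy Q P = (D : EReal) ∧
      Real.log 2 * D = -entropy Q - ∑ a, Q a * Real.log (P a) := by
  refine ⟨∑ a, Q a * Real.logb 2 (Q a / P a), by rw [relEntropy, if_pos h], ?_⟩
  have hl : Real.log 2 ≠ 0 := by positivity
  rw [entropy_eq_neg_sum, neg_neg, ← sum_sub_distrib, mul_sum]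
  refine sum_congr rfl fun a _ => ?_
  by_cases h0 : Q a = 0
  · simp [h0]
  · rw [Real.logb, Real.log_div h0 (fun h1 => h0 (h a h1))]
    field_simp

end Entropy

/-! ### The exponent of a joint distribution and the single-letter formula. -/

section Exponent

variable {𝒳 𝒴 𝒵 : Type*} [Fintype 𝒳] [Fintype 𝒴] [Fintype 𝒵]
  [DecidableEq 𝒳] [DecidableEq 𝒴] [DecidableEq 𝒵]

lemma condMutualInfo_eq (T : 𝒳 × 𝒴 × 𝒵 → ℝ) (hT : ∀ a, 0 ≤ T a) :
    Real.log 2 * condMutualInfo (fun x y z => T (x, y, z)) =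
      entropy (push (fun a => (a.1, a.2.1)) T) + entropy (push Prod.snd T) -
        entropy (push (fun a => a.2.1) T) - entropy T := by
  have h1 : ∀ x y, ∑ z, T (x, y, z) = push (fun a => (a.1, a.2.1)) T (x, y) := fun x y => by
    simp [push, sum_filter, Fintype.sum_prod_type, ite_and, sum_ite_zero_right]
  have h2 : ∀ y z, ∑ x, T (x, y, z) = push Prod.snd T (y, z) := fun y z => by
    simp [push, sum_filter, Fintype.sum_prod_type]
  have h3 : ∀ y, ∑ x, ∑ z, T (x, y, z) = push (fun a => a.2.1) T y := fun y => by
    simp [push, sum_filter, Fintype.sum_prod_type, sum_ite_zero_right]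
  have hl : Real.log 2 ≠ 0 := by positivity
  have e : condMutualInfo (fun x y z => T (x, y, z)) = ∑ a, T a * Real.logb 2
      ((T a * push (fun a => a.2.1) T a.2.1) /
        (push (fun a => (a.1, a.2.1)) T (a.1, a.2.1) * push Prod.snd T a.2)) := by
    simp only [condMutualInfo, h3]
    simp only [h1, h2, Fintype.sum_prod_type]
  have h4 : ∀ a : 𝒳 × 𝒴 × 𝒵, Real.log 2 * (T a * Real.logb 2
      ((T a * push (fun a => a.2.1) T a.2.1) /
        (push (fun a => (a.1, a.2.1)) T (a.1, a.2.1) * push Prod.snd T a.2))) =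
      T a * Real.log (T a) + T a * Real.log (push (fun a => a.2.1) T ((fun a => a.2.1) a)) -
        T a * Real.log (push (fun a => (a.1, a.2.1)) T ((fun a => (a.1, a.2.1)) a)) -
        T a * Real.log (push Prod.snd T (Prod.snd a)) := by
    intro a
    rcases (hT a).eq_or_lt with h0 | h0
    · simp [← h0]
    · have p1 := h0.trans_le (le_push (fun a => a.2.1) hT a)
      have p2 := h0.trans_le (le_push (fun a => (a.1, a.2.1)) hT a)
      have p3 := h0.trans_le (le_push Prod.snd hT a)
      rw [Real.logb, Real.log_div (mul_pos h0 p1).ne' (mul_pos p2 p3).ne',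
        Real.log_mul p2.ne' p3.ne', Real.log_mul h0.ne' p1.ne']
      field_simp
      ring
  rw [e, mul_sum, sum_congr rfl fun a _ => h4 a, sum_sub_distrib, sum_sub_distrib,
    sum_add_distrib, sum_mul_log_push, sum_mul_log_push, sum_mul_log_push, entropy_eq_neg_sum T]
  ring

/-- The exponent (in nats) of the joint type `T`. -/
noncomputable def typeExponent (P : 𝒳 × 𝒴 → ℝ) (R : ℝ) (T : 𝒳 × 𝒴 × 𝒵 → ℝ) : ℝ :=
  max (entropy (push Prod.snd T) - entropy (push (fun a => a.2.1) T))
    (entropy (push (fun a => a.2.2) T) - R * Real.log 2) - entropy T -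
    ∑ a, T a * Real.log (P (a.1, a.2.1))

/-- Zeros of `P` do no harm: the coefficients `Real.log (P _)` are real constants, so the last sum
is linear in `T`. Absolute continuity is imposed separately, as a closed condition in
`feasibleJoint`. -/
lemma continuous_typeExponent (P : 𝒳 × 𝒴 → ℝ) (R : ℝ) :
    Continuous (typeExponent P R : (𝒳 × 𝒴 × 𝒵 → ℝ) → ℝ) := by
  refine ((((continuous_entropy.comp (continuous_push _)).sub
    (continuous_entropy.comp (continuous_push _))).max
    ((continuous_entropy.comp (continuous_push _)).sub continuous_const)).sub
    continuous_entropy).sub ?_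
  fun_prop

/-- The joint mass function `Q W` on triples. -/
def jointTriple (Q : 𝒳 × 𝒴 → ℝ) (W : 𝒳 × 𝒴 → 𝒵 → ℝ) (a : 𝒳 × 𝒴 × 𝒵) : ℝ :=
  Q (a.1, a.2.1) * W (a.1, a.2.1) a.2.2

lemma push_jointTriple (Q : 𝒳 × 𝒴 → ℝ) {W : 𝒳 × 𝒴 → 𝒵 → ℝ} (hW : ∀ q, ∑ z, W q z = 1) :
    push (fun a => (a.1, a.2.1)) (jointTriple Q W) = Q := by
  ext ⟨x, y⟩
  have : ∑ z, Q (x, y) * W (x, y) z = Q (x, y) := by rw [← mul_sum, hW, mul_one]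
  simpa [push, jointTriple, sum_filter, Fintype.sum_prod_type, ite_and, sum_ite_zero_right] using this

lemma innerObjective_eq {Q : 𝒳 × 𝒴 → ℝ} (hQ : ∀ q, 0 ≤ Q q) (R : ℝ) {W : 𝒳 × 𝒴 → 𝒵 → ℝ}
    (hW : ∀ q, W q ∈ stdSimplex ℝ 𝒵) :
    Real.log 2 * innerObjective Q R W =
      entropy Q + max (entropy (push Prod.snd (jointTriple Q W)) -
          entropy (push (fun a => a.2.1) (jointTriple Q W)))
        (entropy (push (fun a => a.2.2) (jointTriple Q W)) - R * Real.log 2) -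
        entropy (jointTriple Q W) := by
  have hT : ∀ a, 0 ≤ jointTriple Q W a := fun a => mul_nonneg (hQ _) ((hW _).1 _)
  have h1 := condMutualInfo_eq (jointTriple Q W) hT
  rw [push_jointTriple Q fun q => (hW q).2] at h1
  have h2 := mutualInfo_eq (push Prod.snd (jointTriple Q W)) (push_nonneg _ hT)
  rw [push_push, push_push] at h2
  have e1 : condMutualInfo (joint Q W) =
    condMutualInfo (fun x y z => jointTriple Q W (x, y, z)) := rfl
  have e2 : (fun y z => ∑ x, joint Q W x y z) =
      fun y z => push Prod.snd (jointTriple Q W) (y, z) := by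
    ext y z
    simp [push, jointTriple, joint, sum_filter, Fintype.sum_prod_type]
  have hl : 0 ≤ Real.log 2 := by positivity
  rw [innerObjective, e1, e2, mul_add, h1, mul_max_of_nonneg _ _ hl, mul_sub, h2]
  change _ + max (Real.log 2 * 0) (entropy (push (fun a => a.2.1) (jointTriple Q W)) +
    entropy (push (fun a => a.2.2) (jointTriple Q W)) - _ - _) = _
  -- With a = H(YZ), b = H(Y), c = H(Z), r = R log 2, the term H(YZ) - H(Y) of the conditional
  -- mutual information is absorbed into the positive part.
  have e3 : ∀ a b c r : ℝ, max (Real.log 2 * 0) (b + c - a - r) = max (a - b) (c - r) - (a - b) := by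
    intro a b c r
    rw [← max_sub_sub_right]
    congr 1 <;> ring_nf
  rw [e3]
  ring_nf

/-- The first two terms on the right are log 2 · D(Q‖P) when Q ≪ P, so this links the count of
sequences to the single-letter objective. -/
lemma typeExponent_jointTriple {P Q : 𝒳 × 𝒴 → ℝ} (hQ : ∀ q, 0 ≤ Q q) (R : ℝ)
    {W : 𝒳 × 𝒴 → 𝒵 → ℝ} (hW : ∀ q, W q ∈ stdSimplex ℝ 𝒵) :
    typeExponent P R (jointTriple Q W) =
      -entropy Q - ∑ q, Q q * Real.log (P q) + Real.log 2 * innerObjective Q R W := by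
  have h := sum_mul_comp (fun a : 𝒳 × 𝒴 × 𝒵 => (a.1, a.2.1)) (jointTriple Q W)
    (fun q => Real.log (P q))
  rw [push_jointTriple Q fun q => (hW q).2] at h
  rw [innerObjective_eq hQ R hW, typeExponent, h]
  ring

lemma sum_joint_mul (Q : 𝒳 × 𝒴 → ℝ) (W : 𝒳 × 𝒴 → 𝒵 → ℝ) (d : 𝒳 → 𝒵 → ℝ) :
    ∑ x, ∑ y, ∑ z, joint Q W x y z * d x z = ∑ a, jointTriple Q W a * d a.1 a.2.2 := by
  simp only [Fintype.sum_prod_type, joint, jointTriple]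

lemma isCompact_feasible (Q : 𝒳 × 𝒴 → ℝ) (d : 𝒳 → 𝒵 → ℝ) (Δ : ℝ) :
    IsCompact (feasible Q d Δ) := by
  have h : feasible Q d Δ = (Set.pi Set.univ fun _ : 𝒳 × 𝒴 => stdSimplex ℝ 𝒵) ∩
      {W | ∑ x, ∑ y, ∑ z, joint Q W x y z * d x z ≤ Δ} := by
    ext W; simp [feasible]
  rw [h]
  refine (isCompact_univ_pi fun _ => isCompact_stdSimplex ℝ 𝒵).inter_right
    (isClosed_le ?_ continuous_const)
  unfold joint
  fun_prop

/-- The minimum defining the inner exponent is attained. -/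
lemma exists_innerObjective_eq {Q : 𝒳 × 𝒴 → ℝ} (hQ : ∀ q, 0 ≤ Q q) (d : 𝒳 → 𝒵 → ℝ) (R Δ : ℝ)
    (h : (feasible Q d Δ).Nonempty) :
    ∃ W ∈ feasible Q d Δ, (innerObjective Q R W : EReal) = innerExponent Q d R Δ := by
  have hl : 0 < Real.log 2 := by positivity
  have hj : Continuous fun W : 𝒳 × 𝒴 → 𝒵 → ℝ => jointTriple Q W := by
    unfold jointTriple
    fun_prop
  -- The defining quotients inside logarithms can degenerate at zero masses; the entropy form, valid
  -- on the feasible set, is continuous there.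
  have hcont : ContinuousOn (innerObjective Q R) (feasible Q d Δ) := by
    have hc : Continuous fun W : 𝒳 × 𝒴 → 𝒵 → ℝ => (entropy Q +
        max (entropy (push Prod.snd (jointTriple Q W)) -
          entropy (push (fun a => a.2.1) (jointTriple Q W)))
        (entropy (push (fun a => a.2.2) (jointTriple Q W)) - R * Real.log 2) -
        entropy (jointTriple Q W)) / Real.log 2 := by
      refine Continuous.div_const ?_ _
      exact (continuous_const.add
        (((continuous_entropy.comp ((continuous_push _).comp hj)).sub
          (continuous_entropy.comp ((continuous_push _).comp hj))).max
        ((continuous_entropy.comp ((continuous_push _).comp hj)).sub continuous_const))).sub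
        (continuous_entropy.comp hj)
    refine hc.continuousOn.congr fun W hW => ?_
    simp only [← innerObjective_eq hQ R hW.1]
    field_simp
  obtain ⟨W, hW, hmin⟩ := (isCompact_feasible Q d Δ).exists_isMinOn h hcont
  refine ⟨W, hW, le_antisymm (le_iInf₂ fun W' hW' => ?_) (iInf₂_le W hW)⟩
  exact EReal.coe_le_coe_iff.2 (hmin hW')

/-- The joint distributions absolutely continuous with respect to `P` that meet the distortion
constraint. -/
def feasibleJoint (P : 𝒳 × 𝒴 → ℝ) (d : 𝒳 → 𝒵 → ℝ) (Δ : ℝ) : Set (𝒳 × 𝒴 × 𝒵 → ℝ) :=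
  {T | T ∈ stdSimplex ℝ (𝒳 × 𝒴 × 𝒵) ∧ (∀ a, P (a.1, a.2.1) = 0 → T a = 0) ∧
    ∑ a, T a * d a.1 a.2.2 ≤ Δ}

lemma isCompact_feasibleJoint (P : 𝒳 × 𝒴 → ℝ) (d : 𝒳 → 𝒵 → ℝ) (Δ : ℝ) :
    IsCompact (feasibleJoint P d Δ) := by
  have h : feasibleJoint P d Δ = stdSimplex ℝ (𝒳 × 𝒴 × 𝒵) ∩
      ((⋂ a : 𝒳 × 𝒴 × 𝒵, ⋂ _ : P (a.1, a.2.1) = 0, {T | T a = 0}) ∩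
        {T | ∑ a, T a * d a.1 a.2.2 ≤ Δ}) := by
    ext T
    simp only [feasibleJoint, Set.mem_inter_iff, Set.mem_iInter, Set.mem_ofPred_eq]
  rw [h]
  refine (isCompact_stdSimplex ℝ (𝒳 × 𝒴 × 𝒵)).inter_right (IsClosed.inter ?_ ?_)
  · exact isClosed_iInter fun a => isClosed_iInter fun _ =>
      isClosed_eq (continuous_apply a) continuous_const
  · exact isClosed_le (by fun_prop) continuous_const

lemma jointTriple_mem_feasibleJoint {P Q : 𝒳 × 𝒴 → ℝ} {d : 𝒳 → 𝒵 → ℝ} {Δ : ℝ}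
    (hQ : Q ∈ stdSimplex ℝ (𝒳 × 𝒴)) (hPQ : ∀ q, P q = 0 → Q q = 0) {W : 𝒳 × 𝒴 → 𝒵 → ℝ}
    (hW : W ∈ feasible Q d Δ) : jointTriple Q W ∈ feasibleJoint P d Δ := by
  refine ⟨⟨fun a => mul_nonneg (hQ.1 _) ((hW.1 _).1 _), ?_⟩, fun a ha => ?_, ?_⟩
  · rw [← sum_push (fun a => (a.1, a.2.1)), push_jointTriple Q fun q => (hW.1 q).2, hQ.2]
  · rw [jointTriple, hPQ _ ha, zero_mul]
  · rw [← sum_joint_mul]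
    exact hW.2

/-- Disintegration: minimizing over joint distributions is the same as minimizing over `Q` and then
over `W`. -/
lemma exists_eq_jointTriple [Nonempty 𝒵] {P : 𝒳 × 𝒴 → ℝ} {d : 𝒳 → 𝒵 → ℝ} {Δ : ℝ}
    {T : 𝒳 × 𝒴 × 𝒵 → ℝ} (hT : T ∈ feasibleJoint P d Δ) :
    ∃ Q ∈ stdSimplex ℝ (𝒳 × 𝒴), (∀ q, P q = 0 → Q q = 0) ∧
      ∃ W ∈ feasible Q d Δ, T = jointTriple Q W := by
  obtain ⟨⟨h0, h1⟩, hP, hd⟩ := hT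
  set Q := push (fun a : 𝒳 × 𝒴 × 𝒵 => (a.1, a.2.1)) T with hQ
  have hQ0 : ∀ q, 0 ≤ Q q := push_nonneg _ h0
  have hQs : ∀ q, Q q = ∑ z, T (q.1, q.2, z) := fun ⟨x, y⟩ => by
    simp [hQ, push, sum_filter, Fintype.sum_prod_type, ite_and, sum_ite_zero_right]
  obtain ⟨z₀⟩ := ‹Nonempty 𝒵›
  -- Where `Q` vanishes the conditional law is irrelevant; a point mass keeps it a probability
  -- vector.
  let W : 𝒳 × 𝒴 → 𝒵 → ℝ := fun q z =>
    if Q q = 0 then (Pi.single z₀ 1 : 𝒵 → ℝ) z else T (q.1, q.2, z) / Q q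
  have hTW : T = jointTriple Q W := by
    ext a
    simp only [jointTriple, W]
    split_ifs with h
    · rw [h, zero_mul]
      exact le_antisymm (h ▸ le_push (fun a : 𝒳 × 𝒴 × 𝒵 => (a.1, a.2.1)) h0 a) (h0 a)
    · field_simp
  refine ⟨Q, ⟨hQ0, by rw [hQ, sum_push, h1]⟩, fun q hq => ?_, W, ⟨fun q => ?_, ?_⟩, hTW⟩
  · rw [hQs]
    exact sum_eq_zero fun z _ => hP _ hq
  · by_cases h : Q q = 0
    · simp only [W, h, if_true]
      exact single_mem_stdSimplex ℝ z₀
    · simp only [W, h, if_false]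
      refine ⟨fun z => div_nonneg (h0 _) (hQ0 _), ?_⟩
      rw [← sum_div, ← hQs, div_self h]
  · rw [sum_joint_mul, ← hTW]
    exact hd

/-- The single-letter formula, in terms of a minimizing joint distribution. -/
lemma isLeast_of_isMinOn [Nonempty 𝒵] {P : 𝒳 × 𝒴 → ℝ} {d : 𝒳 → 𝒵 → ℝ} {R Δ : ℝ}
    {T : 𝒳 × 𝒴 × 𝒵 → ℝ} (hT : T ∈ feasibleJoint P d Δ)
    (hmin : IsMinOn (typeExponent P R) (feasibleJoint P d Δ) T) :
    IsLeast ((fun Q => relEntropy Q P + innerExponent Q d R Δ) '' stdSimplex ℝ (𝒳 × 𝒴))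
      ((typeExponent P R T / Real.log 2 : ℝ) : EReal) := by
  have hl : 0 < Real.log 2 := by positivity
  have lower : ∀ Q ∈ stdSimplex ℝ (𝒳 × 𝒴),
      ((typeExponent P R T / Real.log 2 : ℝ) : EReal) ≤
        relEntropy Q P + innerExponent Q d R Δ := by
    intro Q hQ
    by_cases hPQ : ∀ q, P q = 0 → Q q = 0
    · obtain ⟨D, hD, hD'⟩ := relEntropy_eq hPQ
      rcases (feasible Q d Δ).eq_empty_or_nonempty with he | hne
      · simp [innerExponent, he, hD]
      · obtain ⟨W, hW, hWe⟩ := exists_innerObjective_eq hQ.1 d R Δ hne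
        rw [← hWe, hD, ← EReal.coe_add, EReal.coe_le_coe_iff, div_le_iff₀ hl]
        refine (hmin (jointTriple_mem_feasibleJoint hQ hPQ hW)).trans ?_
        rw [typeExponent_jointTriple hQ.1 R hW.1, ← hD']
        linarith
    -- In `EReal` one has ⊤ + ⊥ = ⊥, so the inner exponent must be shown to differ from ⊥.
    · rw [relEntropy, if_neg hPQ, EReal.top_add_of_ne_bot]
      · exact le_top
      · rcases (feasible Q d Δ).eq_empty_or_nonempty with he | hne
        · simp [innerExponent, he]
        · obtain ⟨W, hW, hWe⟩ := exists_innerObjective_eq hQ.1 d R Δ hne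
          rw [← hWe]
          exact EReal.coe_ne_bot _
  refine ⟨?_, by rintro _ ⟨Q, hQ, rfl⟩; exact lower Q hQ⟩
  obtain ⟨Q, hQ, hPQ, W, hW, rfl⟩ := exists_eq_jointTriple hT
  refine ⟨Q, hQ, le_antisymm ?_ (lower Q hQ)⟩
  obtain ⟨D, hD, hD'⟩ := relEntropy_eq hPQ
  calc relEntropy Q P + innerExponent Q d R Δ
      ≤ relEntropy Q P + (innerObjective Q R W : EReal) := by
        gcongr
        exact iInf₂_le W hW
    _ = _ := by
        rw [hD, ← EReal.coe_add, EReal.coe_eq_coe_iff, typeExponent_jointTriple hQ.1 R hW.1, ← hD']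
        field_simp

end Exponent

/-! ### Error estimates, rounding to types, and the limit. -/

section Asymptotics

variable {𝒳 𝒴 𝒵 : Type*} [Fintype 𝒳] [Fintype 𝒴] [Fintype 𝒵]
  [DecidableEq 𝒳] [DecidableEq 𝒴] [DecidableEq 𝒵]

lemma one_le_two_rpow (n : ℕ) {R : ℝ} (hR : 0 ≤ R) : 1 ≤ (2 : ℝ) ^ ((n : ℝ) * R) :=
  Real.one_le_rpow (by norm_num) (by positivity)

lemma numMessages_pos (n : ℕ) {R : ℝ} (hR : 0 ≤ R) : 0 < numMessages n R :=
  Nat.floor_pos.2 (one_le_two_rpow n hR)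

/-- As 2^(nR) ≥ 1, the floor loses at most a factor 2, and log 2 ≤ 1. -/
lemma abs_log_numMessages_sub_le (n : ℕ) {R : ℝ} (hR : 0 ≤ R) :
    |Real.log (numMessages n R) - n * (R * Real.log 2)| ≤ 1 := by
  have h1 := one_le_two_rpow n hR
  have e : (n : ℝ) * (R * Real.log 2) = Real.log ((2 : ℝ) ^ ((n : ℝ) * R)) := by
    rw [Real.log_rpow (by norm_num)]; ring
  have hM : (0 : ℝ) < numMessages n R := by exact_mod_cast numMessages_pos n hR
  have hM1 : (1 : ℝ) ≤ numMessages n R := by exact_mod_cast numMessages_pos n hR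
  have hle : (numMessages n R : ℝ) ≤ (2 : ℝ) ^ ((n : ℝ) * R) := Nat.floor_le (by linarith)
  have hlt : (2 : ℝ) ^ ((n : ℝ) * R) < numMessages n R + 1 := Nat.lt_floor_add_one _
  have h2 := Real.log_le_log hM hle
  have h3 := Real.log_le_log (by linarith) (by linarith :
    (2 : ℝ) ^ ((n : ℝ) * R) ≤ 2 * numMessages n R)
  rw [Real.log_mul (by norm_num) hM.ne'] at h3
  have h4 : Real.log 2 ≤ 1 := by linarith [Real.log_le_sub_one_of_pos (x := 2) (by norm_num)]
  rw [e, abs_le]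
  constructor <;> linarith

lemma typeBound_pos {P : 𝒳 × 𝒴 → ℝ} (hP : ∀ q, 0 ≤ P q) {n M : ℕ} (hM : 0 < M)
    {k : 𝒳 × 𝒴 × 𝒵 → ℕ} (hk : ∑ a, k a = n) (hPk : ∀ a, P (a.1, a.2.1) = 0 → k a = 0) :
    0 < typeBound P n M k := by
  have h1 := card_typeClass_push_pos hk (fun a => a.2.1)
  have h2 := card_typeClass_push_pos hk (fun a => a.2.2)
  have h3 := card_typeClass_push_pos hk Prod.snd
  have h4 := typeClass_card_pos hk
  have h5 : 0 < typeWeight P k := by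
    refine prod_pos fun a _ => ?_
    by_cases h : P (a.1, a.2.1) = 0
    · simp [hPk a h]
    · exact pow_pos ((hP _).lt_of_ne' h) _
  unfold typeBound
  positivity

lemma log_typeWeight {P : 𝒳 × 𝒴 → ℝ} {n : ℕ} (hn : 0 < n) {k : 𝒳 × 𝒴 × 𝒵 → ℕ}
    (hPk : ∀ a, P (a.1, a.2.1) = 0 → k a = 0) :
    Real.log (typeWeight P k) = n * ∑ a, (k a : ℝ) / n * Real.log (P (a.1, a.2.1)) := by
  rw [typeWeight, Real.log_prod, mul_sum]
  · refine sum_congr rfl fun a _ => ?_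
    rw [Real.log_pow]
    field_simp
  · intro a _
    by_cases h : P (a.1, a.2.1) = 0
    · simp [hPk a h]
    · exact pow_ne_zero _ h

/-- A constant for the polynomial factors in the estimates by types. -/
def errorConst (𝒳 𝒴 𝒵 : Type*) [Fintype 𝒳] [Fintype 𝒴] [Fintype 𝒵] : ℕ :=
  Fintype.card 𝒴 + Fintype.card 𝒵 + Fintype.card (𝒴 × 𝒵) + Fintype.card (𝒳 × 𝒴 × 𝒵) + 1

lemma abs_log_typeBound_add_le {P : 𝒳 × 𝒴 → ℝ} (hP : ∀ q, 0 ≤ P q) {n : ℕ} (hn : 0 < n)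
    {R : ℝ} (hR : 0 ≤ R) {k : 𝒳 × 𝒴 × 𝒵 → ℕ} (hk : ∑ a, k a = n)
    (hPk : ∀ a, P (a.1, a.2.1) = 0 → k a = 0) :
    |Real.log (typeBound P n (numMessages n R) k) +
        n * typeExponent P R (fun a => (k a : ℝ) / n)| ≤
      errorConst 𝒳 𝒴 𝒵 * (1 + Real.log (n + 1)) := by
  have hn' : (0 : ℝ) < n := by exact_mod_cast hn
  have pY := card_typeClass_push_pos hk (fun a => a.2.1)
  have pZ := card_typeClass_push_pos hk (fun a => a.2.2)
  have pYZ := card_typeClass_push_pos hk Prod.snd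
  have p0 := typeClass_card_pos hk
  have hM := numMessages_pos n hR
  have hpos := typeBound_pos hP hM hk hPk
  have hw : 0 < typeWeight P k := by
    by_contra h
    rw [typeBound] at hpos
    have := mul_nonpos_of_nonneg_of_nonpos
      (by positivity : (0 : ℝ) ≤ min ((#(typeClass n (push (fun a => a.2.1) k)) : ℝ) /
        #(typeClass n (push Prod.snd k))) (numMessages n R /
        #(typeClass n (push (fun a => a.2.2) k))) * #(typeClass n k)) (not_lt.1 h)
    linarith
  have log_min : ∀ {a b : ℝ}, 0 < a → 0 < b →
      Real.log (min a b) = min (Real.log a) (Real.log b) := by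
    intro a b ha hb
    rcases le_total a b with h | h
    · rw [min_eq_left h, min_eq_left (Real.log_le_log ha h)]
    · rw [min_eq_right h, min_eq_right (Real.log_le_log hb h)]
  have e1 : Real.log (typeBound P n (numMessages n R) k) =
      min (Real.log #(typeClass n (push (fun a => a.2.1) k)) -
          Real.log #(typeClass n (push Prod.snd k)))
        (Real.log (numMessages n R) - Real.log #(typeClass n (push (fun a => a.2.2) k))) +
      Real.log #(typeClass n k) + n * ∑ a, (k a : ℝ) / n * Real.log (P (a.1, a.2.1)) := by
    rw [typeBound, Real.log_mul (by positivity) hw.ne', Real.log_mul (by positivity) (by positivity),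
      log_min (by positivity) (by positivity), Real.log_div (by positivity) (by positivity),
      Real.log_div (by positivity) (by positivity), log_typeWeight hn hPk]
  have bY := abs_log_card_typeClass_sub_le (push (fun a => a.2.1) k) (by rw [sum_push, hk]) hn
  have bZ := abs_log_card_typeClass_sub_le (push (fun a => a.2.2) k) (by rw [sum_push, hk]) hn
  have bYZ := abs_log_card_typeClass_sub_le (push Prod.snd k) (by rw [sum_push, hk]) hn
  have b0 := abs_log_card_typeClass_sub_le k hk hn
  have bM := abs_log_numMessages_sub_le n hR
  rw [e1, typeExponent, push_div, push_div, push_div]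
  set lY := Real.log #(typeClass n (push (fun a => a.2.1) k))
  set lZ := Real.log #(typeClass n (push (fun a => a.2.2) k))
  set lYZ := Real.log #(typeClass n (push Prod.snd k))
  set l0 := Real.log #(typeClass n k)
  set lM := Real.log (numMessages n R)
  set hY := entropy fun b => ((push (fun a => a.2.1) k b : ℕ) : ℝ) / n
  set hZ := entropy fun b => ((push (fun a => a.2.2) k b : ℕ) : ℝ) / n
  set hYZ := entropy fun b => ((push Prod.snd k b : ℕ) : ℝ) / n
  set h0 := entropy fun a => (k a : ℝ) / n
  set w := ∑ a, (k a : ℝ) / n * Real.log (P (a.1, a.2.1))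
  set L := 1 + Real.log ((n : ℝ) + 1) with hL
  have hL1 : 1 ≤ L := by
    have := Real.log_nonneg (x := (n : ℝ) + 1) (by linarith)
    linarith
  have e2 : min (lY - lYZ) (lM - lZ) + l0 + n * w +
      n * (max (hYZ - hY) (hZ - R * Real.log 2) - h0 - w) =
      (min (lY - lYZ) (lM - lZ) - min (n * (hY - hYZ)) (n * (R * Real.log 2 - hZ))) +
        (l0 - n * h0) := by
    have : (n : ℝ) * max (hYZ - hY) (hZ - R * Real.log 2) =
        -min (n * (hY - hYZ)) (n * (R * Real.log 2 - hZ)) := by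
      rw [mul_max_of_nonneg _ _ hn'.le, ← max_neg_neg]
      congr 1 <;> ring
    rw [mul_sub, mul_sub, this]
    ring
  have hc : (errorConst 𝒳 𝒴 𝒵 : ℝ) = Fintype.card 𝒴 + Fintype.card 𝒵 +
      Fintype.card (𝒴 × 𝒵) + Fintype.card (𝒳 × 𝒴 × 𝒵) + 1 := by
    simp [errorConst]
  -- The minimum is 1-Lipschitz for the sup norm, so the errors in its two arguments need not be
  -- tracked by cases.
  have hmin := abs_min_sub_min_le_max (lY - lYZ) (lM - lZ) (n * (hY - hYZ))
    (n * (R * Real.log 2 - hZ))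
  have cY : 0 ≤ (Fintype.card 𝒴 : ℝ) * L := by positivity
  have cZ : 0 ≤ (Fintype.card 𝒵 : ℝ) * L := by positivity
  have cYZ : 0 ≤ (Fintype.card (𝒴 × 𝒵) : ℝ) * L := by positivity
  -- The extra 1 pays for the floor in the number of messages, since `L ≥ 1`.
  have hmax : max |lY - lYZ - n * (hY - hYZ)| |lM - lZ - n * (R * Real.log 2 - hZ)| ≤
      (Fintype.card 𝒴 + Fintype.card 𝒵 + Fintype.card (𝒴 × 𝒵) + 1) * L := by
    rw [abs_le] at bY bZ bYZ bM
    refine max_le ?_ ?_ <;> rw [abs_le] <;> constructor <;> linarith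
  rw [e2, hc]
  refine (abs_add_le _ _).trans ?_
  linarith

/-- A joint type close to `T`, obtained by rounding down and giving the remaining mass to `a₀`. -/
noncomputable def roundType (T : 𝒳 × 𝒴 × 𝒵 → ℝ) (a₀ : 𝒳 × 𝒴 × 𝒵) (n : ℕ) (a : 𝒳 × 𝒴 × 𝒵) : ℕ :=
  ⌊T a * n⌋₊ + if a = a₀ then n - ∑ b, ⌊T b * n⌋₊ else 0

lemma sum_floor_le {T : 𝒳 × 𝒴 × 𝒵 → ℝ} (hT : T ∈ stdSimplex ℝ (𝒳 × 𝒴 × 𝒵)) (n : ℕ) :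
    ∑ b, ⌊T b * n⌋₊ ≤ n := by
  have : (∑ b, (⌊T b * n⌋₊ : ℝ)) ≤ n := by
    calc _ ≤ ∑ b, T b * n :=
          sum_le_sum fun b _ => Nat.floor_le (mul_nonneg (hT.1 b) (Nat.cast_nonneg n))
      _ = n := by rw [← sum_mul, hT.2, one_mul]
  exact_mod_cast this

lemma roundType_cast {T : 𝒳 × 𝒴 × 𝒵 → ℝ} (hT : T ∈ stdSimplex ℝ (𝒳 × 𝒴 × 𝒵))
    (a₀ : 𝒳 × 𝒴 × 𝒵) (n : ℕ) (a : 𝒳 × 𝒴 × 𝒵) : (roundType T a₀ n a : ℝ) =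
      ⌊T a * n⌋₊ + if a = a₀ then (n : ℝ) - ∑ b, (⌊T b * n⌋₊ : ℝ) else 0 := by
  rw [roundType]
  split_ifs
  · rw [Nat.cast_add, Nat.cast_sub (sum_floor_le hT n), Nat.cast_sum]
  · simp

lemma sum_roundType {T : 𝒳 × 𝒴 × 𝒵 → ℝ} (hT : T ∈ stdSimplex ℝ (𝒳 × 𝒴 × 𝒵))
    (a₀ : 𝒳 × 𝒴 × 𝒵) (n : ℕ) : ∑ a, roundType T a₀ n a = n := by
  simp only [roundType, sum_add_distrib, sum_ite_eq', mem_univ, if_true]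
  exact Nat.add_sub_cancel' (sum_floor_le hT n)

lemma tendsto_roundType_div {T : 𝒳 × 𝒴 × 𝒵 → ℝ} (hT : T ∈ stdSimplex ℝ (𝒳 × 𝒴 × 𝒵))
    (a₀ : 𝒳 × 𝒴 × 𝒵) :
    Filter.Tendsto (fun (n : ℕ) a => (roundType T a₀ n a : ℝ) / n) Filter.atTop (nhds T) := by
  have hfl : ∀ a, Filter.Tendsto (fun n : ℕ => (⌊T a * n⌋₊ : ℝ) / n) Filter.atTop (nhds (T a)) :=
    fun a => (tendsto_nat_floor_mul_div_atTop (hT.1 a)).comp tendsto_natCast_atTop_atTop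
  rw [tendsto_pi_nhds]
  intro a
  have hrest : Filter.Tendsto (fun n : ℕ => if a = a₀ then 1 - ∑ b, (⌊T b * n⌋₊ : ℝ) / n else 0)
      Filter.atTop (nhds 0) := by
    split_ifs
    · have := (tendsto_const_nhds (x := (1 : ℝ))).sub
        (tendsto_finsetSum (univ : Finset (𝒳 × 𝒴 × 𝒵)) fun b _ => hfl b)
      rwa [hT.2, sub_self] at this
    · exact tendsto_const_nhds
  have h := (hfl a).add hrest
  rw [add_zero] at h
  refine h.congr' ?_
  filter_upwards [Filter.eventually_gt_atTop 0] with n hn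
  have hn' : (n : ℝ) ≠ 0 := by positivity
  rw [roundType_cast hT, add_div]
  congr 1
  split_ifs
  · rw [sub_div, div_self hn', sum_div]
  · simp

lemma roundType_eq_zero {P : 𝒳 × 𝒴 → ℝ} {d : 𝒳 → 𝒵 → ℝ} {Δ : ℝ} {T : 𝒳 × 𝒴 × 𝒵 → ℝ}
    (hT : T ∈ feasibleJoint P d Δ) {a₀ : 𝒳 × 𝒴 × 𝒵} (h₀ : P (a₀.1, a₀.2.1) ≠ 0) (n : ℕ)
    {a : 𝒳 × 𝒴 × 𝒵} (ha : P (a.1, a.2.1) = 0) : roundType T a₀ n a = 0 := by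
  rw [roundType, hT.2.1 a ha, if_neg (by rintro rfl; exact h₀ ha)]
  simp

/-- Rounding moves mass only from letters in the support of `P` to `a₀`, whose distortion is least
there, so the total distortion cannot grow. -/
lemma isFeasibleType_roundType {P : 𝒳 × 𝒴 → ℝ} {d : 𝒳 → 𝒵 → ℝ} {Δ : ℝ} {T : 𝒳 × 𝒴 × 𝒵 → ℝ}
    (hT : T ∈ feasibleJoint P d Δ) {a₀ : 𝒳 × 𝒴 × 𝒵}
    (hmin : ∀ a : 𝒳 × 𝒴 × 𝒵, P (a.1, a.2.1) ≠ 0 → d a₀.1 a₀.2.2 ≤ d a.1 a.2.2) {n : ℕ}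
    (hn : 0 < n) : IsFeasibleType d Δ n (roundType T a₀ n) := by
  have hn' : (0 : ℝ) < n := by exact_mod_cast hn
  refine ⟨sum_roundType hT.1 a₀ n, ?_⟩
  have h1 : ∑ a, (roundType T a₀ n a : ℝ) * d a.1 a.2.2 =
      ∑ a, (⌊T a * n⌋₊ : ℝ) * d a.1 a.2.2 + ∑ a, (T a * n - ⌊T a * n⌋₊) * d a₀.1 a₀.2.2 := by
    simp only [roundType_cast hT.1, add_mul, sum_add_distrib, ite_mul, zero_mul, sum_ite_eq',
      mem_univ, if_true]
    rw [← sum_mul, sum_sub_distrib, ← sum_mul, hT.1.2, one_mul]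
  have h2 : ∑ a, (roundType T a₀ n a : ℝ) * d a.1 a.2.2 ≤ n * ∑ a, T a * d a.1 a.2.2 := by
    rw [h1, ← sum_add_distrib, mul_sum]
    refine sum_le_sum fun a _ => ?_
    by_cases ha : P (a.1, a.2.1) = 0
    · simp [hT.2.1 a ha]
    · have h3 : (⌊T a * n⌋₊ : ℝ) ≤ T a * n := Nat.floor_le (mul_nonneg (hT.1.1 a) hn'.le)
      have h4 := mul_le_mul_of_nonneg_left (hmin a ha) (sub_nonneg.2 h3)
      linarith
  calc (1 / (n : ℝ)) * ∑ a, (roundType T a₀ n a : ℝ) * d a.1 a.2.2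
      ≤ (1 / (n : ℝ)) * (n * ∑ a, T a * d a.1 a.2.2) := by gcongr
    _ = ∑ a, T a * d a.1 a.2.2 := by field_simp
    _ ≤ Δ := hT.2.2

/-- The expected distortion of the best `h` is an average over the support of `P`, so some letter
there does no worse than `Δ`. -/
lemma exists_dist_le [Nonempty 𝒵] {P : 𝒳 × 𝒴 → ℝ} (hP : P ∈ stdSimplex ℝ (𝒳 × 𝒴))
    {d : 𝒳 → 𝒵 → ℝ} {Δ : ℝ} (hΔ : minDistortion P d ≤ Δ) :
    ∃ a : 𝒳 × 𝒴 × 𝒵, P (a.1, a.2.1) ≠ 0 ∧ d a.1 a.2.2 ≤ Δ := by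
  obtain ⟨h, hh⟩ := exists_eq_ciInf_of_finite
    (f := fun h : 𝒴 → 𝒵 => ∑ x, ∑ y, P (x, y) * d x (h y))
  rw [minDistortion, ← hh] at hΔ
  by_contra! hc
  have hle : ∀ q : 𝒳 × 𝒴, P q * Δ ≤ P q * d q.1 (h q.2) := by
    intro q
    by_cases hq : P q = 0
    · simp [hq]
    · exact mul_le_mul_of_nonneg_left (hc (q.1, q.2, h q.2) hq).le (hP.1 q)
  obtain ⟨q, hq⟩ : ∃ q, P q ≠ 0 := by
    by_contra! h0
    have := hP.2
    simp [h0] at this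
  have hlt : ∑ q, P q * Δ < ∑ q : 𝒳 × 𝒴, P q * d q.1 (h q.2) :=
    sum_lt_sum (fun q _ => hle q) ⟨q, mem_univ q,
      mul_lt_mul_of_pos_left (hc (q.1, q.2, h q.2) hq) ((hP.1 q).lt_of_ne' hq)⟩
  rw [← sum_mul, hP.2, one_mul, Fintype.sum_prod_type] at hlt
  exact absurd hΔ (not_le.2 hlt)

lemma successProb_le_maxSuccessProb (P : 𝒳 × 𝒴 → ℝ) (d : 𝒳 → 𝒵 → ℝ) (n : ℕ) (R Δ : ℝ)
    (f : (Fin n → 𝒴) → Fin (numMessages n R)) (g : Fin (numMessages n R) → (Fin n → 𝒵)) :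
    successProb P d Δ f g ≤ maxSuccessProb P d n R Δ :=
  le_ciSup (f := fun c : ((Fin n → 𝒴) → Fin (numMessages n R)) ×
    (Fin (numMessages n R) → (Fin n → 𝒵)) => successProb P d Δ c.1 c.2)
    (Set.finite_range _).bddAbove (f, g)

lemma typeBound_div_two_le {P : 𝒳 × 𝒴 → ℝ} (hP : ∀ q, 0 ≤ P q) (d : 𝒳 → 𝒵 → ℝ) {n : ℕ}
    {R : ℝ} (hR : 0 ≤ R) (Δ : ℝ) {k : 𝒳 × 𝒴 × 𝒵 → ℕ} (hk : IsFeasibleType d Δ n k) :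
    typeBound P n (numMessages n R) k / 2 ≤ maxSuccessProb P d n R Δ := by
  obtain ⟨f, g, h⟩ := exists_code hP d Δ (numMessages_pos n hR) hk
  exact h.trans (successProb_le_maxSuccessProb P d n R Δ f g)

lemma maxSuccessProb_pos {P : 𝒳 × 𝒴 → ℝ} (hP : ∀ q, 0 ≤ P q) {d : 𝒳 → 𝒵 → ℝ}
    (hd : ∀ x z, 0 ≤ d x z) {R Δ : ℝ} (hR : 0 ≤ R) {a₀ : 𝒳 × 𝒴 × 𝒵}
    (h₀ : P (a₀.1, a₀.2.1) ≠ 0) (hd₀ : d a₀.1 a₀.2.2 ≤ Δ) (n : ℕ) :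
    0 < maxSuccessProb P d n R Δ := by
  -- The constant sequence at `a₀` is feasible. At `n = 0` the average is 0 because `1 / 0 = 0`, and
  -- 0 ≤ Δ follows from `hd`.
  have hk : IsFeasibleType d Δ n (Pi.single a₀ n) := by
    refine ⟨by simp, ?_⟩
    rcases Nat.eq_zero_or_pos n with rfl | hn
    · simpa using (hd _ _).trans hd₀
    · have e : ∑ a : 𝒳 × 𝒴 × 𝒵, ((Pi.single a₀ n : 𝒳 × 𝒴 × 𝒵 → ℕ) a : ℝ) * d a.1 a.2.2 =
          n * d a₀.1 a₀.2.2 := by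
        rw [sum_eq_single a₀ (fun b _ hb => by simp [Pi.single_eq_of_ne hb]) (by simp)]
        simp
      rw [e]
      have : (n : ℝ) ≠ 0 := by positivity
      field_simp
      exact hd₀
  refine lt_of_lt_of_le (half_pos (typeBound_pos hP (numMessages_pos n hR) hk.1 ?_))
    (typeBound_div_two_le hP d hR Δ hk)
  intro a ha
  exact Pi.single_eq_of_ne (by rintro rfl; exact h₀ ha) _

lemma maxSuccessProb_le [Nonempty 𝒵] {P : 𝒳 × 𝒴 → ℝ} (hP : ∀ q, 0 ≤ P q) (d : 𝒳 → 𝒵 → ℝ)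
    {n : ℕ} (hn : 0 < n) {R : ℝ} (hR : 0 ≤ R) (Δ : ℝ) {G : ℝ}
    (hG : ∀ T ∈ feasibleJoint (𝒵 := 𝒵) P d Δ, G ≤ typeExponent P R T) :
    maxSuccessProb P d n R Δ ≤ ((n : ℝ) + 1) ^ Fintype.card (𝒳 × 𝒴 × 𝒵) *
      Real.exp (errorConst 𝒳 𝒴 𝒵 * (1 + Real.log (n + 1)) - n * G) := by
  have hn' : (0 : ℝ) < n := by exact_mod_cast hn
  have : Nonempty (Fin (numMessages n R)) := ⟨⟨0, numMessages_pos n hR⟩⟩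
  refine ciSup_le fun c => successProb_le hP d Δ c.1 c.2 (Real.exp_pos _).le fun k hk => ?_
  by_cases hPk : ∀ a, P (a.1, a.2.1) = 0 → k a = 0
  · have hpos := typeBound_pos hP (numMessages_pos n hR) hk.1 hPk
    have hb := abs_log_typeBound_add_le hP hn hR hk.1 hPk
    have hmem : (fun a => (k a : ℝ) / n) ∈ feasibleJoint P d Δ := by
      refine ⟨⟨fun a => by positivity, ?_⟩, fun a ha => by simp [hPk a ha], ?_⟩
      · rw [← sum_div, ← Nat.cast_sum, hk.1, div_self hn'.ne']
      · refine le_trans (le_of_eq ?_) hk.2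
        rw [mul_sum]
        exact sum_congr rfl fun a _ => by ring
    have h1 := mul_le_mul_of_nonneg_left (hG _ hmem) hn'.le
    rw [← Real.log_le_iff_le_exp hpos]
    linarith [(abs_le.1 hb).2]
  -- A type charging a letter with `P = 0` has weight zero, so it needs no exponent estimate.
  · push Not at hPk
    obtain ⟨a, ha, hka⟩ := hPk
    have : typeWeight P k = 0 := prod_eq_zero (mem_univ a) (by rw [ha, zero_pow hka])
    rw [typeBound, this, mul_zero]
    positivity

lemma tendsto_log_error : Filter.Tendsto (fun n : ℕ => (1 + Real.log ((n : ℝ) + 1)) / n)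
    Filter.atTop (nhds 0) := by
  have h1 : Filter.Tendsto (fun n : ℕ => Real.log ((n + 1 : ℕ) : ℝ) / ((n + 1 : ℕ) : ℝ))
      Filter.atTop (nhds 0) := by
    have h := (Real.isLittleO_log_id_atTop.tendsto_div_nhds_zero).comp
      (tendsto_natCast_atTop_atTop (R := ℝ))
    exact (Filter.tendsto_add_atTop_iff_nat 1).2 h
  have h2 : Filter.Tendsto (fun n : ℕ => 1 / (n : ℝ)) Filter.atTop (nhds 0) :=
    tendsto_one_div_atTop_nhds_zero_nat
  have h3 := h2.add (h1.mul (h2.const_add 1))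
  simp only [zero_mul, add_zero] at h3
  refine h3.congr' ?_
  filter_upwards [Filter.eventually_gt_atTop 0] with n hn
  have hn' : (n : ℝ) ≠ 0 := by positivity
  push_cast
  field_simp

/-- The exponent of the maximal success probability converges to the least exponent of a feasible
joint distribution. -/
lemma tendsto_exponent [Nonempty 𝒵] {P : 𝒳 × 𝒴 → ℝ} (hP : ∀ q, 0 ≤ P q) {d : 𝒳 → 𝒵 → ℝ}
    (hd : ∀ x z, 0 ≤ d x z) {R Δ : ℝ} (hR : 0 ≤ R) {a₀ : 𝒳 × 𝒴 × 𝒵}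
    (h₀ : P (a₀.1, a₀.2.1) ≠ 0) (hd₀ : d a₀.1 a₀.2.2 ≤ Δ)
    (hmin₀ : ∀ a : 𝒳 × 𝒴 × 𝒵, P (a.1, a.2.1) ≠ 0 → d a₀.1 a₀.2.2 ≤ d a.1 a.2.2)
    {T : 𝒳 × 𝒴 × 𝒵 → ℝ} (hT : T ∈ feasibleJoint P d Δ)
    (hmin : IsMinOn (typeExponent P R) (feasibleJoint P d Δ) T) :
    Filter.Tendsto (fun n : ℕ => -(1 / (n : ℝ)) * Real.logb 2 (maxSuccessProb P d n R Δ))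
      Filter.atTop (nhds (typeExponent P R T / Real.log 2)) := by
  have hl : 0 < Real.log 2 := by positivity
  -- The three terms pay for the number of types, the entropy estimates, and the factor 1/2 lost in
  -- the covering.
  set c : ℝ := Fintype.card (𝒳 × 𝒴 × 𝒵) + errorConst 𝒳 𝒴 𝒵 + 1 with hc
  set L : ℕ → ℝ := fun n => (1 + Real.log ((n : ℝ) + 1)) / n with hL
  have herr : Filter.Tendsto (fun n => c * L n) Filter.atTop (nhds 0) := by
    simpa using tendsto_log_error.const_mul c
  have lower : Filter.Tendsto (fun n => (typeExponent P R T - c * L n) / Real.log 2)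
      Filter.atTop (nhds (typeExponent P R T / Real.log 2)) := by
    simpa using (herr.const_sub (typeExponent P R T)).div_const (Real.log 2)
  have upper : Filter.Tendsto (fun n : ℕ =>
      (typeExponent P R (fun a => (roundType T a₀ n a : ℝ) / n) + c * L n) / Real.log 2)
      Filter.atTop (nhds (typeExponent P R T / Real.log 2)) := by
    have := ((continuous_typeExponent P R).tendsto T).comp (tendsto_roundType_div hT.1 a₀)
    simpa using (this.add herr).div_const (Real.log 2)
  have hkey : ∀ n : ℕ, 0 < n → ∀ v : ℝ, -(1 / (n : ℝ)) * Real.logb 2 v =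
      (-Real.log v / n) / Real.log 2 := by
    intro n hn v
    rw [Real.logb]
    ring
  have hlog2 : Real.log 2 ≤ 1 := by linarith [Real.log_le_sub_one_of_pos (x := 2) (by norm_num)]
  refine tendsto_of_tendsto_of_tendsto_of_le_of_le' lower upper ?_ ?_
  · filter_upwards [Filter.eventually_gt_atTop 0] with n hn
    have hn' : (0 : ℝ) < n := by exact_mod_cast hn
    have hlogn : 0 ≤ Real.log ((n : ℝ) + 1) := Real.log_nonneg (by linarith)
    have hpos := maxSuccessProb_pos hP hd hR h₀ hd₀ n
    have hle := Real.log_le_log hpos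
      (maxSuccessProb_le hP d hn hR Δ (fun T' hT' => hmin hT'))
    rw [Real.log_mul (by positivity) (Real.exp_pos _).ne', Real.log_exp, Real.log_pow] at hle
    rw [hkey n hn]
    refine div_le_div_of_nonneg_right ?_ hl.le
    rw [le_div_iff₀ hn']
    have e : (typeExponent P R T - c * L n) * n =
        n * typeExponent P R T - c * (1 + Real.log ((n : ℝ) + 1)) := by
      simp only [hL]
      field_simp
    rw [e, hc]
    have h1 : (0 : ℝ) ≤ Fintype.card (𝒳 × 𝒴 × 𝒵) := by positivity
    nlinarith
  · filter_upwards [Filter.eventually_gt_atTop 0] with n hn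
    have hn' : (0 : ℝ) < n := by exact_mod_cast hn
    have hlogn : 0 ≤ Real.log ((n : ℝ) + 1) := Real.log_nonneg (by linarith)
    have hk := isFeasibleType_roundType hT hmin₀ hn
    have hPk : ∀ a : 𝒳 × 𝒴 × 𝒵, P (a.1, a.2.1) = 0 → roundType T a₀ n a = 0 :=
      fun a ha => roundType_eq_zero hT h₀ n ha
    have hpos := typeBound_pos hP (numMessages_pos n hR) hk.1 hPk
    have hb := (abs_le.1 (abs_log_typeBound_add_le hP hn hR hk.1 hPk)).1
    have hle := Real.log_le_log (half_pos hpos) (typeBound_div_two_le hP d hR Δ hk)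
    rw [Real.log_div hpos.ne' (by norm_num)] at hle
    rw [hkey n hn]
    refine div_le_div_of_nonneg_right ?_ hl.le
    rw [div_le_iff₀ hn']
    have e : (typeExponent P R (fun a => (roundType T a₀ n a : ℝ) / n) + c * L n) * n =
        n * typeExponent P R (fun a => (roundType T a₀ n a : ℝ) / n) +
          c * (1 + Real.log ((n : ℝ) + 1)) := by
      simp only [hL]
      field_simp
    rw [e, hc]
    have h1 : (0 : ℝ) ≤ Fintype.card (𝒳 × 𝒴 × 𝒵) := by positivity
    nlinarith

end Asymptotics

end RemoteLossy

theorem theorem1 {𝒳 𝒴 𝒵 : Type*} [Fintype 𝒳] [Fintype 𝒴] [Fintype 𝒵] [Nonempty 𝒵]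
    (P : 𝒳 × 𝒴 → ℝ) (hP : P ∈ stdSimplex ℝ (𝒳 × 𝒴))
    (d : 𝒳 → 𝒵 → ℝ) (hd : ∀ x z, 0 ≤ d x z)
    (R Δ : ℝ) (hR : 0 ≤ R) (hΔ : RemoteLossy.minDistortion P d ≤ Δ) :
    (∀ n : ℕ, 0 < RemoteLossy.maxSuccessProb P d n R Δ) ∧
    (∀ Q ∈ stdSimplex ℝ (𝒳 × 𝒴), (RemoteLossy.feasible Q d Δ).Nonempty →
      ∃ W ∈ RemoteLossy.feasible Q d Δ,
        (RemoteLossy.innerObjective Q R W : EReal) = RemoteLossy.innerExponent Q d R Δ) ∧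
    ∃ E : ℝ,
      Filter.Tendsto
        (fun n : ℕ => -(1 / (n : ℝ)) * Real.logb 2 (RemoteLossy.maxSuccessProb P d n R Δ))
        Filter.atTop (nhds E) ∧
      IsLeast
        ((fun Q => RemoteLossy.relEntropy Q P + RemoteLossy.innerExponent Q d R Δ) ''
          stdSimplex ℝ (𝒳 × 𝒴))
        (E : EReal) := by
  classical
  obtain ⟨a₁, h₁, hd₁⟩ := RemoteLossy.exists_dist_le hP hΔ
  -- The triple `a₀` of least distortion in the support of `P` serves both as a feasible point mass
  -- and as the place for the rounding remainder.
  obtain ⟨a₀, ha₀, hmin₀⟩ := Finset.exists_min_image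
    ({a | P (a.1, a.2.1) ≠ 0} : Finset (𝒳 × 𝒴 × 𝒵)) (fun a => d a.1 a.2.2) ⟨a₁, by simpa using h₁⟩
  simp only [Finset.mem_filter, Finset.mem_univ, true_and] at ha₀ hmin₀
  have hd₀ := (hmin₀ a₁ h₁).trans hd₁
  have hne : (RemoteLossy.feasibleJoint (𝒵 := 𝒵) P d Δ).Nonempty := by
    refine ⟨Pi.single a₀ 1, single_mem_stdSimplex ℝ a₀, fun a ha => ?_, ?_⟩
    · exact Pi.single_eq_of_ne (by rintro rfl; exact ha₀ ha) _
    · rw [Finset.sum_eq_single a₀ (fun b _ hb => by rw [Pi.single_eq_of_ne hb, zero_mul]) (by simp)]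
      simpa using hd₀
  obtain ⟨T, hT, hmin⟩ := (RemoteLossy.isCompact_feasibleJoint P d Δ).exists_isMinOn hne
    (RemoteLossy.continuous_typeExponent P R).continuousOn
  exact ⟨RemoteLossy.maxSuccessProb_pos hP.1 hd hR ha₀ hd₀,
    fun Q hQ h => RemoteLossy.exists_innerObjective_eq hQ.1 d R Δ h, _,
    RemoteLossy.tendsto_exponent hP.1 hd hR ha₀ hd₀ hmin₀ hT hmin,
    RemoteLossy.isLeast_of_isMinOn hT hmin⟩
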